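/- **Theorem 3.1.** Let $\mathcal Q=\bigoplus_{n\ge 0}\mathcal Q_n$ be the graded Hopf algebra of quasisymmetric functions over $\mathbb Q$ in variables $x_1,x_2,\dots$. Here $\mathcal Q_n$ has as a basis the monomial quasisymmetric functions $M_\alpha=\sum_{i_1<\dots<i_k}x_{i_1}^{a_1}\cdots x_{i_k}^{a_k}$, indexed by the compositions $\alpha=(a_1,\dots,a_k)$ of $n$. The product is that of power series, and the coproduct is $\Delta(M_\alpha)=\sum_{\alpha=\beta\cdot\gamma}M_\beta\otimes M_\gamma$ (sum over all ways to write $\alpha$ as a concatenation of two possibly empty compositions). Let $F_\alpha=\sum_{\beta\ge\alpha}M_\beta$, where $\beta\ge\alpha$ means that $\beta$ refines $\alpha$; the $F_\alpha$ with $\alpha$ a composition of $n$ also form a basis of $\mathcal Q_n$. Let $\Phi$ be an endomorphism of the graded Hopf algebra $\mathcal Q$ (so $\Phi(\mathcal Q_m)\subseteq\mathcal Q_m$ for all $m$), and let $\lambda\in\mathbb Q$ be given by $\Phi(M_1)=\lambda M_1$. Let $n\ge 0$, and for compositions $\alpha,\beta$ of $n$ define $c_{\alpha,\beta}\in\mathbb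 Q$ by $\Phi(F_\alpha)=\sum_{\beta}c_{\alpha,\beta}F_\beta$. Write $c_{\alpha,n}$ for $c_{\alpha,(n)}$, where $(n)$ is the one-part composition (the empty composition if $n=0$). Suppose that the numbers $c_{\alpha,n}$, $\alpha$ a composition of $n$, are nonnegative and not all zero. For a permutation $\sigma\in\mathfrak S_n$ let $D(\sigma)$ be its descent composition, that is, the composition of $n$ whose proper partial sums $a_1,\ a_1+a_2,\ \dots,\ a_1+\cdots+a_{k-1}$ are exactly the $i\in\{1,\dots,n-1\}$ with $\sigma(i)>\sigma(i+1)$. Let $$P_\Phi(\pi)=\frac{c_{D(\pi),n}}{\sum_{\sigma\in\mathfrak S_n}c_{D(\sigma),n}}\qquad(\pi\in\mathfrak S_n)$$ be the $QS^*$-distribution corresponding to $\Phi$. Let $K$ be the matrix indexed by $\mathfrak S_n$ with $K(\pi,\sigma\pi)=P_\Phi(\sigma^{-1})$, where $(\sigma\pi)(i)=\sigma(\pi(i))$. Then: 1. $\lambda^n>0$. 2. The matrix $\overline K(\alpha,\beta)=c_{\alpha,\beta}/\lambda^n$, indexed by the compositions of $n$, is stochastic: its entries are nonnegative and each of its rows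 sums to $1$. 3. $\overline K$ lumps $K$ by descent sets. That is, $K$ is a stochastic matrix; for every composition $\beta$ of $n$ and all $\pi,\tau\in\mathfrak S_n$ with $D(\pi)=D(\tau)$, $$\sum_{\sigma:\,D(\sigma)=\beta}K(\pi,\sigma)=\sum_{\sigma:\,D(\sigma)=\beta}K(\tau,\sigma);$$ and $\overline K(D(\pi),\beta)=\sum_{\sigma:\,D(\sigma)=\beta}K(\pi,\sigma)$ for all $\pi\in\mathfrak S_n$ and all compositions $\beta$ of $n$. -/

import Mathlib

open scoped TensorProduct

namespace QuasiSym

/-! ### Quasisymmetric functions as power series in `x₀, x₁, x₂, …` over `ℚ` -/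

/-- The list of nonzero exponents of the monomial with exponent vector `d`, read in increasing
order of the variables: for `x_{i₁}^{a₁} ⋯ x_{iₖ}^{aₖ}` with `i₁ < ⋯ < iₖ` it is `[a₁, …, aₖ]`. -/
def exponentWord (d : ℕ →₀ ℕ) : List ℕ :=
  (d.support.sort (· ≤ ·)).map d

/-- The monomial quasisymmetric function
`M_α = ∑_{i₁ < ⋯ < iₖ} x_{i₁}^{a₁} ⋯ x_{iₖ}^{aₖ}` of a composition `α = (a₁, …, aₖ)`, as a power
series: every monomial whose exponent word is `α` occurs with coefficient one, the others do
not occur. -/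
def monomialSeries {n : ℕ} (α : Composition n) : MvPowerSeries ℕ ℚ :=
  fun d => if exponentWord d = α.blocks then 1 else 0

theorem coeff_monomialSeries {n : ℕ} (α : Composition n) (d : ℕ →₀ ℕ) :
    MvPowerSeries.coeff d (monomialSeries α) = if exponentWord d = α.blocks then 1 else 0 :=
  rfl

theorem exponentWord_embDomain {k : ℕ} (i : Fin k ↪o ℕ) (e : Fin k →₀ ℕ) :
    exponentWord (e.embDomain i.toEmbedding) = (e.support.sort (· ≤ ·)).map e := by
  unfold exponentWord
  rw [Finsupp.support_embDomain, ← Finset.map_sort (r := (· ≤ ·)), List.map_map]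
  · refine List.map_congr_left fun x _ => ?_
    exact Finsupp.embDomain_apply_self i.toEmbedding e x
  · intro a _ b _
    exact i.le_iff_le.symm

theorem exists_exponentWord_eq {n : ℕ} (α : Composition n) :
    ∃ d : ℕ →₀ ℕ, exponentWord d = α.blocks := by
  refine ⟨(Finsupp.equivFunOnFinite.symm α.blocksFun).embDomain (Fin.valOrderEmb α.length).toEmbedding, ?_⟩
  rw [exponentWord_embDomain]
  have h : (Finsupp.equivFunOnFinite.symm α.blocksFun).support = Finset.univ := by
    ext j
    have := α.one_le_blocksFun j
    simp only [Finsupp.mem_support_iff, Finsupp.coe_equivFunOnFinite_symm, Finset.mem_univ, iff_true]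
    omega
  rw [h, Fin.sort_univ]
  simpa [List.ofFn_eq_map] using α.ofFn_blocksFun

theorem sum_exponentWord (d : ℕ →₀ ℕ) : (exponentWord d).sum = d.degree := by
  unfold exponentWord
  rw [Finsupp.degree_apply, ← Multiset.sum_coe, ← Multiset.map_coe, Finset.sort_eq]
  rfl

/-- The exponent word of a monomial of degree `n` is a composition of `n`. -/
def exponentComposition (d : ℕ →₀ ℕ) : Composition d.degree where
  blocks := exponentWord d
  blocks_pos := by
    intro a ha
    simp only [exponentWord, List.mem_map, Finset.mem_sort, Finsupp.mem_support_iff] at ha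
    obtain ⟨i, hi, rfl⟩ := ha
    exact Nat.pos_of_ne_zero hi
  blocks_sum := sum_exponentWord d

theorem exists_embDomain (d : ℕ →₀ ℕ) {k : ℕ} (h : d.support.card = k) :
    ∃ e : Fin k →₀ ℕ, (∀ j, e j ≠ 0) ∧
      e.embDomain (d.support.orderEmbOfFin h).toEmbedding = d := by
  refine ⟨d.comapDomain (d.support.orderEmbOfFin h)
    (d.support.orderEmbOfFin h).injective.injOn, ?_, ?_⟩
  · intro j
    rw [Finsupp.comapDomain_apply]
    exact Finsupp.mem_support_iff.1 (d.support.orderEmbOfFin_mem h j)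
  · refine Finsupp.embDomain_comapDomain (f := (d.support.orderEmbOfFin h).toEmbedding) ?_
    exact (d.support.range_orderEmbOfFin h).ge

theorem exists_common_embDomain {d d' : ℕ →₀ ℕ} (h : exponentWord d = exponentWord d') :
    ∃ (k : ℕ) (e : Fin k →₀ ℕ) (i i' : Fin k ↪o ℕ),
      e.embDomain i.toEmbedding = d ∧ e.embDomain i'.toEmbedding = d' := by
  have hk : d'.support.card = d.support.card := by
    have := congrArg List.length h
    simpa [exponentWord] using this.symm
  obtain ⟨e, he, hd⟩ := exists_embDomain d rfl
  obtain ⟨e', he', hd'⟩ := exists_embDomain d' hk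
  have hee : e = e' := by
    have h1 := exponentWord_embDomain (d.support.orderEmbOfFin rfl) e
    have h2 := exponentWord_embDomain (d'.support.orderEmbOfFin hk) e'
    have hs : e.support = Finset.univ := by ext j; simpa using he j
    have hs' : e'.support = Finset.univ := by ext j; simpa using he' j
    rw [hd, hs, Fin.sort_univ] at h1
    rw [hd', hs', Fin.sort_univ, ← h, h1] at h2
    ext j
    exact List.map_inj_left.1 h2 j (List.mem_finRange j)
  subst hee
  exact ⟨_, e, _, _, hd, hd'⟩

/-- A power series of bounded degree in which any two monomials
`x_{i₁}^{a₁} ⋯ x_{iₖ}^{aₖ}` and `x_{j₁}^{a₁} ⋯ x_{jₖ}^{aₖ}` with `i₁ < ⋯ < iₖ` and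
`j₁ < ⋯ < jₖ` have the same coefficient. -/
def IsQuasiSymmetric (f : MvPowerSeries ℕ ℚ) : Prop :=
  (∃ N : ℕ, ∀ d : ℕ →₀ ℕ, N ≤ d.degree → MvPowerSeries.coeff d f = 0) ∧
    ∀ d d' : ℕ →₀ ℕ, exponentWord d = exponentWord d' →
      MvPowerSeries.coeff d f = MvPowerSeries.coeff d' f

/-- The space of quasisymmetric functions: all linear combinations of the `M_α`. -/
def monomialSpan : Submodule ℚ (MvPowerSeries ℕ ℚ) :=
  Submodule.span ℚ (Set.range fun p : Σ n, Composition n => monomialSeries p.2)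

theorem isQuasiSymmetric_monomialSeries {n : ℕ} (α : Composition n) :
    IsQuasiSymmetric (monomialSeries α) := by
  refine ⟨⟨n + 1, fun d hd => ?_⟩, fun d d' h => ?_⟩
  · rw [coeff_monomialSeries, if_neg]
    intro h
    have := sum_exponentWord d
    rw [h, α.blocks_sum] at this
    omega
  · rw [coeff_monomialSeries, coeff_monomialSeries, h]

theorem mem_monomialSpan_iff (f : MvPowerSeries ℕ ℚ) :
    f ∈ monomialSpan ↔ IsQuasiSymmetric f := by
  constructor
  · intro hf
    induction hf using Submodule.span_induction with
    | mem x hx =>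
      obtain ⟨p, rfl⟩ := hx
      exact isQuasiSymmetric_monomialSeries p.2
    | zero => exact ⟨⟨0, fun d _ => by simp⟩, fun d d' _ => by simp⟩
    | add x y _ _ hx hy =>
      obtain ⟨⟨N, hN⟩, hx⟩ := hx
      obtain ⟨⟨N', hN'⟩, hy⟩ := hy
      refine ⟨⟨max N N', fun d hd => ?_⟩, fun d d' h => ?_⟩
      · rw [map_add, hN d (le_trans (le_max_left _ _) hd),
          hN' d (le_trans (le_max_right _ _) hd), add_zero]
      · rw [map_add, map_add, hx d d' h, hy d d' h]
    | smul a x _ hx =>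
      obtain ⟨⟨N, hN⟩, hx⟩ := hx
      refine ⟨⟨N, fun d hd => ?_⟩, fun d d' h => ?_⟩
      · rw [map_smul, hN d hd, smul_zero]
      · rw [map_smul, map_smul, hx d d' h]
  · rintro ⟨⟨N, hN⟩, hf⟩
    choose r hr using fun p : Σ n, Composition n => exists_exponentWord_eq p.2
    have key : f = ∑ p ∈ (Finset.range N).sigma fun n => (Finset.univ : Finset (Composition n)),
        MvPowerSeries.coeff (r p) f • monomialSeries p.2 := by
      ext d
      rw [map_sum]
      simp only [map_smul, coeff_monomialSeries, smul_eq_mul, mul_ite, mul_one, mul_zero]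
      by_cases hd : N ≤ d.degree
      · rw [hN d hd, Finset.sum_eq_zero]
        intro p hp
        rw [if_neg]
        intro h
        have h1 := sum_exponentWord d
        rw [h, p.2.blocks_sum] at h1
        simp only [Finset.mem_sigma, Finset.mem_range, Finset.mem_univ, and_true] at hp
        omega
      · rw [Finset.sum_eq_single (⟨d.degree, exponentComposition d⟩ : Σ n, Composition n)]
        · rw [if_pos]
          · exact hf _ _ (hr ⟨d.degree, exponentComposition d⟩).symm
          · rfl
        · intro p _ hp
          rw [if_neg]
          intro h
          apply hp
          rw [Composition.sigma_eq_iff_blocks_eq]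
          exact h.symm
        · intro h
          exact absurd (by simpa using hd) h
    rw [key]
    exact Submodule.sum_mem _ fun p _ =>
      Submodule.smul_mem _ _ (Submodule.subset_span ⟨p, rfl⟩)

theorem coeff_embDomain_mul {k : ℕ} (f g : MvPowerSeries ℕ ℚ) (e : Fin k →₀ ℕ)
    (i : Fin k ↪o ℕ) :
    MvPowerSeries.coeff (e.embDomain i.toEmbedding) (f * g) =
      ∑ p ∈ Finset.HasAntidiagonal.antidiagonal e, MvPowerSeries.coeff (p.1.embDomain i.toEmbedding) f *
        MvPowerSeries.coeff (p.2.embDomain i.toEmbedding) g := by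
  classical
  rw [MvPowerSeries.coeff_mul]
  symm
  refine Finset.sum_bij (fun p _ => (p.1.embDomain i.toEmbedding, p.2.embDomain i.toEmbedding))
    ?_ ?_ ?_ ?_
  · intro p hp
    rw [Finset.HasAntidiagonal.mem_antidiagonal] at hp ⊢
    rw [← hp, Finsupp.embDomain_add]
  · intro p _ q _ h
    rw [Prod.mk.injEq] at h
    exact Prod.ext (Finsupp.embDomain_injective _ h.1) (Finsupp.embDomain_injective _ h.2)
  · intro q hq
    rw [Finset.HasAntidiagonal.mem_antidiagonal] at hq
    have hsupp : ∀ j, j ∉ Set.range i.toEmbedding → q.1 j = 0 ∧ q.2 j = 0 := by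
      intro j hj
      have := DFunLike.congr_fun hq j
      rw [Finsupp.embDomain_of_notMem_range _ _ _ hj, Finsupp.add_apply] at this
      omega
    have h1 : (q.1.comapDomain i.toEmbedding i.toEmbedding.injective.injOn).embDomain
        i.toEmbedding = q.1 := by
      refine Finsupp.embDomain_comapDomain fun j hj => ?_
      by_contra hc
      exact Finsupp.mem_support_iff.1 hj (hsupp j hc).1
    have h2 : (q.2.comapDomain i.toEmbedding i.toEmbedding.injective.injOn).embDomain
        i.toEmbedding = q.2 := by
      refine Finsupp.embDomain_comapDomain fun j hj => ?_
      by_contra hc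
      exact Finsupp.mem_support_iff.1 hj (hsupp j hc).2
    refine ⟨(_, _), ?_, Prod.ext h1 h2⟩
    rw [Finset.HasAntidiagonal.mem_antidiagonal]
    apply Finsupp.embDomain_injective i.toEmbedding
    rw [Finsupp.embDomain_add, ← hq]
    exact congrArg₂ (· + ·) h1 h2
  · intro p _
    rfl

theorem IsQuasiSymmetric.mul {f g : MvPowerSeries ℕ ℚ} (hf : IsQuasiSymmetric f)
    (hg : IsQuasiSymmetric g) : IsQuasiSymmetric (f * g) := by
  classical
  obtain ⟨⟨N, hN⟩, hf⟩ := hf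
  obtain ⟨⟨N', hN'⟩, hg⟩ := hg
  refine ⟨⟨N + N', fun d hd => ?_⟩, fun d d' h => ?_⟩
  · rw [MvPowerSeries.coeff_mul]
    refine Finset.sum_eq_zero fun p hp => ?_
    rw [Finset.HasAntidiagonal.mem_antidiagonal] at hp
    rw [← hp, map_add] at hd
    rcases le_or_gt N p.1.degree with h | h
    · rw [hN _ h, zero_mul]
    · rw [hN' p.2 (by omega), mul_zero]
  · obtain ⟨k, e, i, i', rfl, rfl⟩ := exists_common_embDomain h
    rw [coeff_embDomain_mul, coeff_embDomain_mul]
    refine Finset.sum_congr rfl fun p _ => ?_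
    congr 1
    · exact hf _ _ (by rw [exponentWord_embDomain, exponentWord_embDomain])
    · exact hg _ _ (by rw [exponentWord_embDomain, exponentWord_embDomain])

/-- The algebra `𝒬` of quasisymmetric functions over `ℚ`: the linear span of the monomial
quasisymmetric functions, with the multiplication of power series. -/
def QSym : Subalgebra ℚ (MvPowerSeries ℕ ℚ) where
  carrier := monomialSpan
  add_mem' := fun ha hb => monomialSpan.add_mem ha hb
  mul_mem' := fun {a b} ha hb =>
    (mem_monomialSpan_iff _).2 (((mem_monomialSpan_iff a).1 ha).mul ((mem_monomialSpan_iff b).1 hb))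
  algebraMap_mem' := by
    classical
    intro r
    refine (mem_monomialSpan_iff _).2 ⟨⟨1, fun d hd => ?_⟩, fun d d' h => ?_⟩
    · rw [MvPowerSeries.algebraMap_apply, MvPowerSeries.coeff_C, if_neg]
      rintro rfl
      simp at hd
    · have hz : d = 0 ↔ d' = 0 := by
        rw [← Finsupp.degree_eq_zero_iff, ← Finsupp.degree_eq_zero_iff, ← sum_exponentWord,
          ← sum_exponentWord, h]
      rw [MvPowerSeries.algebraMap_apply, MvPowerSeries.coeff_C, MvPowerSeries.coeff_C]
      simp only [hz]

/-- `M_α` as an element of `𝒬`. -/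
def monomialQ {n : ℕ} (α : Composition n) : QSym :=
  ⟨monomialSeries α, Submodule.subset_span ⟨⟨n, α⟩, rfl⟩⟩

theorem linearIndependent_monomialQ :
    LinearIndependent ℚ fun p : Σ n, Composition n => monomialQ p.2 := by
  apply LinearIndependent.of_comp QSym.val.toLinearMap
  rw [linearIndependent_iff']
  intro s g hg p hp
  obtain ⟨d, hd⟩ := exists_exponentWord_eq p.2
  have h := congrArg (MvPowerSeries.coeff d) hg
  rw [map_sum, map_zero] at h
  rw [Finset.sum_eq_single p] at h
  · have h1 : MvPowerSeries.coeff d (monomialSeries p.2) = 1 := by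
      rw [coeff_monomialSeries, if_pos hd]
    rw [map_smul] at h
    change g p * MvPowerSeries.coeff d (monomialSeries p.2) = 0 at h
    rwa [h1, mul_one] at h
  · intro q _ hq
    rw [map_smul]
    change g q * MvPowerSeries.coeff d (monomialSeries q.2) = 0
    rw [coeff_monomialSeries, if_neg, mul_zero]
    intro hc
    apply hq
    rw [Composition.sigma_eq_iff_blocks_eq, ← hc, hd]
  · exact fun h => absurd hp h

theorem span_monomialQ :
    ⊤ ≤ Submodule.span ℚ (Set.range fun p : Σ n, Composition n => monomialQ p.2) := by
  rintro ⟨f, hf⟩ -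
  have hf' : f ∈ monomialSpan := hf
  have key : ∀ f ∈ monomialSpan, ∀ hf : f ∈ QSym, (⟨f, hf⟩ : QSym) ∈
      Submodule.span ℚ (Set.range fun p : Σ n, Composition n => monomialQ p.2) := by
    intro f hf
    induction hf using Submodule.span_induction with
    | mem x hx =>
      obtain ⟨p, rfl⟩ := hx
      exact fun _ => Submodule.subset_span ⟨p, rfl⟩
    | zero => exact fun _ => Submodule.zero_mem _
    | add x y hx hy ihx ihy => exact fun _ => Submodule.add_mem _ (ihx hx) (ihy hy)
    | smul a x hx ih => exact fun _ => Submodule.smul_mem _ a (ih hx)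
  exact key f hf' hf

/-- The basis `(M_α)` of `𝒬`, indexed by all compositions of all `n ≥ 0`. -/
noncomputable def monomialBasis : Module.Basis (Σ n, Composition n) ℚ QSym :=
  Module.Basis.mk linearIndependent_monomialQ span_monomialQ

@[simp] theorem monomialBasis_apply (p : Σ n, Composition n) :
    monomialBasis p = monomialQ p.2 := by
  simp [monomialBasis]

/-! ### The coproduct and the grading -/

/-- The composition formed by the first `k` parts of `α`. -/
def takeParts {n : ℕ} (α : Composition n) (k : ℕ) : Composition (α.blocks.take k).sum where
  blocks := α.blocks.take k
  blocks_pos := fun h => α.blocks_pos (List.mem_of_mem_take h)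
  blocks_sum := rfl

/-- The composition formed by all parts of `α` but the first `k`. -/
def dropParts {n : ℕ} (α : Composition n) (k : ℕ) : Composition (α.blocks.drop k).sum where
  blocks := α.blocks.drop k
  blocks_pos := fun h => α.blocks_pos (List.mem_of_mem_drop h)
  blocks_sum := rfl

/-- The coalgebra structure of `𝒬`: the coproduct is `Δ(M_α) = ∑_{α = β · γ} M_β ⊗ M_γ`, the sum
over all ways to write `α` as a concatenation of two, possibly empty, compositions; the counit is
the constant term. -/
noncomputable instance : CoalgebraStruct ℚ QSym where
  comul := monomialBasis.constr ℚ fun p =>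
    ∑ k ∈ Finset.range (p.2.length + 1),
      monomialQ (takeParts p.2 k) ⊗ₜ[ℚ] monomialQ (dropParts p.2 k)
  counit := monomialBasis.constr ℚ fun p => if p.1 = 0 then 1 else 0

theorem comul_monomialQ {n : ℕ} (α : Composition n) :
    CoalgebraStruct.comul (R := ℚ) (monomialQ α) = ∑ k ∈ Finset.range (α.length + 1),
      monomialQ (takeParts α k) ⊗ₜ[ℚ] monomialQ (dropParts α k) := by
  have := monomialBasis.constr_basis ℚ (fun p : Σ n, Composition n =>
    ∑ k ∈ Finset.range (p.2.length + 1),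
      monomialQ (takeParts p.2 k) ⊗ₜ[ℚ] monomialQ (dropParts p.2 k)) ⟨n, α⟩
  rw [monomialBasis_apply] at this
  exact this

/-- The homogeneous component `𝒬ₙ`, the span of the `M_α` with `α` a composition of `n`. -/
noncomputable def homogeneous (n : ℕ) : Submodule ℚ QSym :=
  Submodule.span ℚ (Set.range fun α : Composition n => monomialQ α)

theorem linearIndependent_monomialQ_degree (n : ℕ) :
    LinearIndependent ℚ fun α : Composition n => monomialQ α :=
  linearIndependent_monomialQ.comp (fun α : Composition n => (⟨n, α⟩ : Σ n, Composition n))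
    sigma_mk_injective

/-- The basis `(M_α)` of `𝒬ₙ`. -/
noncomputable def monomialBasisDegree (n : ℕ) : Module.Basis (Composition n) ℚ (homogeneous n) :=
  Module.Basis.span (linearIndependent_monomialQ_degree n)

theorem coe_monomialBasisDegree {n : ℕ} (α : Composition n) :
    (monomialBasisDegree n α : QSym) = monomialQ α :=
  congrArg Subtype.val (Module.Basis.span_apply (linearIndependent_monomialQ_degree n) α)

/-! ### Compositions and subsets, the fundamental basis -/

/-- The bijection `α ↦ S_α = {a₁, a₁ + a₂, …, a₁ + ⋯ + a_{k-1}}` from the compositions of `n` to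
the subsets of `[n - 1] = {1, …, n - 1}`; here `i : Fin (n - 1)` stands for `i + 1 ∈ [n - 1]`. -/
def partialSums (n : ℕ) : Composition n ≃ Finset (Fin (n - 1)) :=
  (compositionEquiv n).trans (compositionAsSetEquiv n)

/-- The fundamental quasisymmetric function `F_α = ∑_{β ≥ α} M_β`, where `β ≥ α` means that `β`
refines `α`, that is, `S_α ⊆ S_β`. -/
noncomputable def fundamentalQ {n : ℕ} (α : Composition n) : QSym :=
  ∑ β : Composition n with partialSums n α ⊆ partialSums n β, monomialQ β

theorem monomialQ_mem {n : ℕ} (α : Composition n) : monomialQ α ∈ homogeneous n :=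
  Submodule.subset_span ⟨α, rfl⟩

theorem fundamentalQ_mem {n : ℕ} (α : Composition n) : fundamentalQ α ∈ homogeneous n :=
  Submodule.sum_mem _ fun β _ => monomialQ_mem β

theorem monomialQ_mem_span_fundamentalQ {n : ℕ} (m : ℕ) :
    ∀ α : Composition n, (partialSums n α)ᶜ.card = m →
      monomialQ α ∈ Submodule.span ℚ (Set.range fun α : Composition n => fundamentalQ α) := by
  induction m using Nat.strong_induction_on with
  | _ m ih =>
    intro α hα
    have hmem : α ∈ Finset.univ.filter
        (fun β : Composition n => partialSums n α ⊆ partialSums n β) := by simp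
    have h : monomialQ α = fundamentalQ α - ∑ β ∈ (Finset.univ.filter
        (fun β : Composition n => partialSums n α ⊆ partialSums n β)).erase α, monomialQ β := by
      rw [fundamentalQ, ← Finset.add_sum_erase _ _ hmem, add_sub_cancel_right]
    rw [h]
    refine Submodule.sub_mem _ (Submodule.subset_span ⟨α, rfl⟩)
      (Submodule.sum_mem _ fun β hβ => ?_)
    rw [Finset.mem_erase, Finset.mem_filter] at hβ
    refine ih _ ?_ β rfl
    rw [← hα]
    apply Finset.card_lt_card
    rw [Finset.compl_ssubset_compl]
    exact hβ.2.2.ssubset_of_ne fun hc => hβ.1 ((partialSums n).injective hc).symm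

theorem span_fundamentalQ (n : ℕ) :
    ⊤ ≤ Submodule.span ℚ (Set.range fun α : Composition n =>
      (⟨fundamentalQ α, fundamentalQ_mem α⟩ : homogeneous n)) := by
  have hle : homogeneous n ≤ (Submodule.span ℚ (Set.range fun α : Composition n =>
      (⟨fundamentalQ α, fundamentalQ_mem α⟩ : homogeneous n))).map (homogeneous n).subtype := by
    rw [Submodule.map_span, ← Set.range_comp]
    refine Submodule.span_le.2 ?_
    rintro _ ⟨α, rfl⟩
    exact monomialQ_mem_span_fundamentalQ _ α rfl
  rintro ⟨x, hx⟩ -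
  obtain ⟨y, hy, hyx⟩ := hle hx
  have : y = ⟨x, hx⟩ := Subtype.ext hyx
  rwa [← this]

/-- The fundamental quasisymmetric functions form a basis `(F_α)` of `𝒬ₙ`. -/
noncomputable def fundamentalBasis (n : ℕ) : Module.Basis (Composition n) ℚ (homogeneous n) :=
  basisOfTopLeSpanOfCardEqFinrank (fun α => ⟨fundamentalQ α, fundamentalQ_mem α⟩)
    (span_fundamentalQ n)
    (Module.finrank_eq_card_basis (monomialBasisDegree n)).symm

theorem coe_fundamentalBasis {n : ℕ} (α : Composition n) :
    (fundamentalBasis n α : QSym) = fundamentalQ α := by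
  simp [fundamentalBasis]

/-! ### Hopf endomorphisms and their matrices -/

/-- `End(𝒬)`: the endomorphisms of the graded Hopf algebra `𝒬`, that is, the linear maps
compatible with product, unit, coproduct and counit (and then automatically with the antipode)
that preserve the degree. -/
structure HopfEnd where
  toBialgHom : QSym →ₐc[ℚ] QSym
  map_homogeneous : ∀ n : ℕ, ∀ f ∈ homogeneous n, toBialgHom f ∈ homogeneous n

namespace HopfEnd

/-- The restriction `Φₙ : 𝒬ₙ → 𝒬ₙ`. -/
noncomputable def degreePart (Φ : HopfEnd) (n : ℕ) : homogeneous n →ₗ[ℚ] homogeneous n :=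
  (Φ.toBialgHom : QSym →ₗ[ℚ] QSym).restrict (Φ.map_homogeneous n)

/-- The coefficients `c_{α,β}` of the expansion `Φ(F_α) = ∑_β c_{α,β} F_β`. -/
noncomputable def coeffF (Φ : HopfEnd) {n : ℕ} (α β : Composition n) : ℚ :=
  (fundamentalBasis n).repr (Φ.degreePart n (fundamentalBasis n α)) β

theorem apply_fundamentalQ (Φ : HopfEnd) {n : ℕ} (α : Composition n) :
    Φ.toBialgHom (fundamentalQ α) = ∑ β : Composition n, Φ.coeffF α β • fundamentalQ β := by
  have h := congrArg Subtype.val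
    ((fundamentalBasis n).sum_repr (Φ.degreePart n (fundamentalBasis n α)))
  have h2 : ((Φ.degreePart n (fundamentalBasis n α) : homogeneous n) : QSym) =
      Φ.toBialgHom (fundamentalQ α) := by
    rw [← coe_fundamentalBasis]
    rfl
  rw [← h2, ← h, Submodule.coe_sum]
  refine Finset.sum_congr rfl fun β _ => ?_
  rw [Submodule.coe_smul, coe_fundamentalBasis]
  rfl

/-- The number `λ` with `Φ(M_1) = λ M_1`: the coefficient of `M_1` in `Φ(M_1)`. -/
noncomputable def scale (Φ : HopfEnd) : ℚ :=
  (monomialBasisDegree 1).repr (Φ.degreePart 1 (monomialBasisDegree 1 (Composition.ones 1)))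
    (Composition.ones 1)

theorem apply_monomialQ_one (Φ : HopfEnd) :
    Φ.toBialgHom (monomialQ (Composition.ones 1)) =
      Φ.scale • monomialQ (Composition.ones 1) := by
  have h := congrArg Subtype.val ((monomialBasisDegree 1).sum_repr
    (Φ.degreePart 1 (monomialBasisDegree 1 (Composition.ones 1))))
  have hu : (Finset.univ : Finset (Composition 1)) = {Composition.ones 1} := by
    refine Finset.eq_singleton_iff_unique_mem.2 ⟨Finset.mem_univ _, fun α _ => ?_⟩
    have : Fintype.card (Composition 1) ≤ 1 := by simp [composition_card]
    exact Fintype.card_le_one_iff.1 this _ _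
  have h2 : ((Φ.degreePart 1 (monomialBasisDegree 1 (Composition.ones 1)) : homogeneous 1) :
      QSym) = Φ.toBialgHom (monomialQ (Composition.ones 1)) := by
    rw [← coe_monomialBasisDegree]
    rfl
  rw [hu, Finset.sum_singleton, h2, Submodule.coe_smul, coe_monomialBasisDegree] at h
  exact h.symm

end HopfEnd

/-! ### Descents and random walks on permutations -/

/-- The one-part composition `(n)`; for `n = 0` it is the empty composition. -/
def onePart : (n : ℕ) → Composition n
  | 0 => Composition.ones 0
  | n + 1 => Composition.single (n + 1) n.succ_pos

theorem partialSums_onePart (n : ℕ) : partialSums n (onePart n) = ∅ := by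
  cases n with
  | zero => exact Finset.eq_empty_iff_forall_notMem.2 fun i => i.elim0
  | succ n =>
    have hb : (Composition.single (n + 1) n.succ_pos).toCompositionAsSet.boundaries.card = 2 := by
      rw [Composition.toCompositionAsSet_boundaries, Composition.card_boundaries_eq_succ_length,
        Composition.single_length]
    rw [Finset.eq_empty_iff_forall_notMem]
    intro i hi
    have hi' : (⟨1 + (i : ℕ), by omega⟩ : Fin (n + 1).succ) ∈
        (Composition.single (n + 1) n.succ_pos).toCompositionAsSet.boundaries := by
      have h0 := (Set.mem_toFinset (s := {i : Fin (n + 1 - 1) | (⟨1 + (i : ℕ), by omega⟩ :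
        Fin (n + 1).succ) ∈ (Composition.single (n + 1) n.succ_pos).toCompositionAsSet.boundaries})
        (a := i)).1 hi
      exact h0
    have h3 : ({0, ⟨1 + (i : ℕ), by omega⟩, Fin.last (n + 1)} : Finset (Fin (n + 1).succ)) ⊆
        (Composition.single (n + 1) n.succ_pos).toCompositionAsSet.boundaries := by
      intro x hx
      simp only [Finset.mem_insert, Finset.mem_singleton] at hx
      rcases hx with rfl | rfl | rfl
      · exact CompositionAsSet.zero_mem _
      · exact hi'
      · exact CompositionAsSet.getLast_mem _
    have h4 := Finset.card_le_card h3
    have hlt : (i : ℕ) < n := i.2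
    rw [hb, Finset.card_eq_three.2 ⟨_, _, _, ?_, ?_, ?_, rfl⟩] at h4
    · omega
    · simp only [ne_eq, Fin.ext_iff, Fin.val_zero]
      omega
    · simp [Fin.ext_iff]
    · simp only [ne_eq, Fin.ext_iff, Fin.val_last]
      omega

/-- The descent set `{i ∈ [n - 1] : σ_i > σ_{i+1}}`; here `i : Fin (n - 1)` stands for
`i + 1 ∈ [n - 1]`. -/
def descentSet {n : ℕ} (σ : Equiv.Perm (Fin n)) : Finset (Fin (n - 1)) :=
  {i | σ ⟨i + 1, by omega⟩ < σ ⟨i, by omega⟩}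

/-- The descent composition `D(σ)`: the composition `α` of `n` with `S_α = Des(σ)`. -/
def descentComposition {n : ℕ} (σ : Equiv.Perm (Fin n)) : Composition n :=
  (partialSums n).symm (descentSet σ)

/-- `Kbar` lumps `K` by descent sets: `K` is the transition matrix of a Markov chain on the
permutations, the probability to move in one step from `π` into a given descent class depends
only on the descent composition of `π`, and `Kbar` is the transition matrix of the chain induced
on descent compositions. -/
structure LumpsByDescents {n : ℕ} (Kbar : Matrix (Composition n) (Composition n) ℚ)
    (K : Matrix (Equiv.Perm (Fin n)) (Equiv.Perm (Fin n)) ℚ) : Prop where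
  stochastic : K ∈ Matrix.rowStochastic ℚ (Equiv.Perm (Fin n))
  lumpable : ∀ (β : Composition n) (π τ : Equiv.Perm (Fin n)),
    descentComposition π = descentComposition τ →
      ∑ σ : Equiv.Perm (Fin n) with descentComposition σ = β, K π σ =
        ∑ σ : Equiv.Perm (Fin n) with descentComposition σ = β, K τ σ
  lump_eq : ∀ (π : Equiv.Perm (Fin n)) (β : Composition n),
    Kbar (descentComposition π) β =
      ∑ σ : Equiv.Perm (Fin n) with descentComposition σ = β, K π σ

namespace HopfEnd

/-- The `QS*`-distribution on `𝔖ₙ` corresponding to `Φ`: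
`P_Φ(π) = c_{D(π),n} / ∑_σ c_{D(σ),n}`. -/
noncomputable def qsDistribution (Φ : HopfEnd) {n : ℕ} (π : Equiv.Perm (Fin n)) : ℚ :=
  Φ.coeffF (descentComposition π) (onePart n) /
    ∑ σ : Equiv.Perm (Fin n), Φ.coeffF (descentComposition σ) (onePart n)

/-- The left random walk on `𝔖ₙ` in which `π` goes to `σπ` with probability `P_Φ(σ⁻¹)`:
`K(π, σπ) = P_Φ(σ⁻¹)`, that is, `K(π, τ) = P_Φ((τπ⁻¹)⁻¹)`. The product is the composition of
maps, `(σπ)(i) = σ(π(i))`. -/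
noncomputable def walk (Φ : HopfEnd) (n : ℕ) :
    Matrix (Equiv.Perm (Fin n)) (Equiv.Perm (Fin n)) ℚ :=
  Matrix.of fun π τ => Φ.qsDistribution (τ * π⁻¹)⁻¹

theorem walk_apply (Φ : HopfEnd) {n : ℕ} (π σ : Equiv.Perm (Fin n)) :
    Φ.walk n π (σ * π) = Φ.qsDistribution σ⁻¹ := by
  simp [walk]

/-- The matrix `K̄(α, β) = c_{α,β} / λⁿ`. -/
noncomputable def normalizedMatrix (Φ : HopfEnd) (n : ℕ) :
    Matrix (Composition n) (Composition n) ℚ :=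
  Matrix.of fun α β => Φ.coeffF α β / Φ.scale ^ n

end HopfEnd

end QuasiSym

open scoped TensorProduct

namespace QuasiSym

/-! ### Partial sums of lists -/

/-! Everything follows from one identity, valid for every `Φ` without any positivity
(`coeffF_descentComposition`): c_{D(π),β} = ∑_{D(τ)=β} c_{D(πτ⁻¹),n}. Since K(π,τ) = P_Φ(πτ⁻¹), the
right side divided by λⁿ is the probability that the walk moves from π into the descent class of β.
So these block sums depend only on D(π). As every composition is a descent composition, K̄ inherits
stochasticity from K.

To prove the identity, compute the coefficient of M_γ in Φ(F_{D(π)}) in two ways, for γ =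
(g₁,…,g_k). From the F-expansion it is the sum of c_{D(π),β} over the β refined by γ. On the other
hand, it is read off by the iterated coproduct followed by the functionals "coefficient of
M_{(g_i)}". The map Φ respects coproduct and degree, and the component of degrees (g₁,…,g_k) of the
iterated coproduct of F_{D(π)} is the tensor product of the fundamental functions of the consecutive
segments of the word of π. The coefficient of M_{(g)} in degree g is that of x₀^g, which is
multiplicative, and Φ is multiplicative too. So the result is the coefficient of x₀ⁿ in Φ of the
product of the segment functions (`monomialCoeff_apply_wordQ`). That product is the sum of
F_{D(πτ⁻¹)} over the τ whose descents are partial sums of γ (`segmentsQ_permWord`). This is the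
identity summed over all β refined by γ, and inclusion-exclusion (`eq_of_sum_partialSums_subset_eq`)
isolates the single β.

For γ = (1,…,1) every segment function is M₁, so ∑_σ c_{D(σ),n} = λⁿ. This is the normalizing
constant, and it is positive under the hypotheses. -/

/-- The set of all sums of initial segments of a list. -/
def cuts : List ℕ → Set ℕ
  | [] => {0}
  | a :: l => insert 0 ((a + ·) '' cuts l)

theorem zero_mem_cuts (l : List ℕ) : 0 ∈ cuts l := by
  cases l <;> simp [cuts]

theorem mem_cuts_cons {a p : ℕ} {l : List ℕ} :
    p ∈ cuts (a :: l) ↔ p = 0 ∨ ∃ q ∈ cuts l, a + q = p := Iff.rfl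

theorem le_sum_of_mem_cuts {p : ℕ} {l : List ℕ} (h : p ∈ cuts l) : p ≤ l.sum := by
  induction l generalizing p with
  | nil => simp_all [cuts]
  | cons a l ih =>
    rw [mem_cuts_cons] at h
    rw [List.sum_cons]
    rcases h with rfl | ⟨q, hq, rfl⟩
    · omega
    · have := ih hq
      omega

theorem mem_cuts_append {p : ℕ} {l l' : List ℕ} :
    p ∈ cuts (l ++ l') ↔ p ∈ cuts l ∨ ∃ q ∈ cuts l', l.sum + q = p := by
  induction l generalizing p with
  | nil =>
    simp only [List.nil_append, cuts, Set.mem_singleton_iff, List.sum_nil, zero_add,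
      exists_eq_right]
    exact ⟨Or.inr, fun h => h.elim (fun h => h ▸ zero_mem_cuts l') id⟩
  | cons a l ih =>
    simp only [List.cons_append, mem_cuts_cons, ih, List.sum_cons]
    constructor
    · rintro (h | ⟨q, h | ⟨r, hr, rfl⟩, rfl⟩)
      · exact Or.inl (Or.inl h)
      · exact Or.inl (Or.inr ⟨q, h, rfl⟩)
      · exact Or.inr ⟨r, hr, by omega⟩
    · rintro ((h | ⟨q, h, rfl⟩) | ⟨r, hr, rfl⟩)
      · exact Or.inl h
      · exact Or.inr ⟨q, Or.inl h, rfl⟩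
      · exact Or.inr ⟨l.sum + r, Or.inr ⟨r, hr, rfl⟩, by omega⟩

theorem mem_cuts_iff_exists_take {p : ℕ} {l : List ℕ} :
    p ∈ cuts l ↔ ∃ k ≤ l.length, (l.take k).sum = p := by
  induction l generalizing p with
  | nil => simp [cuts, eq_comm]
  | cons a l ih =>
    rw [mem_cuts_cons]
    constructor
    · rintro (rfl | ⟨q, hq, rfl⟩)
      · exact ⟨0, by simp⟩
      · obtain ⟨k, hk, rfl⟩ := ih.1 hq
        exact ⟨k + 1, by simpa using hk, by simp⟩
    · rintro ⟨k, hk, rfl⟩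
      cases k with
      | zero => simp
      | succ k => exact Or.inr ⟨_, ih.2 ⟨k, by simpa using hk, rfl⟩, by simp⟩

theorem mem_partialSums {n : ℕ} (β : Composition n) (i : Fin (n - 1)) :
    i ∈ partialSums n β ↔ (i : ℕ) + 1 ∈ cuts β.blocks := by
  have h : i ∈ partialSums n β ↔
      (⟨1 + (i : ℕ), by omega⟩ : Fin n.succ) ∈ β.boundaries := by
    rw [← Composition.toCompositionAsSet_boundaries]
    exact Set.mem_toFinset (s := {i : Fin (n - 1) | (⟨1 + (i : ℕ), by omega⟩ :
        Fin n.succ) ∈ β.toCompositionAsSet.boundaries}) (a := i)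
  rw [h, ← Composition.toCompositionAsSet_boundaries,
    CompositionAsSet.mem_boundaries_iff_exists_blocks_sum_take_eq,
    Composition.toCompositionAsSet_blocks, mem_cuts_iff_exists_take]
  have hb : β.toCompositionAsSet.boundaries.card = β.blocks.length + 1 := by
    rw [Composition.toCompositionAsSet_boundaries, Composition.card_boundaries_eq_succ_length]
  rw [hb]
  simp only [Nat.lt_succ_iff, add_comm 1]

/-- An initial segment of a strictly increasing list consists of its entries below some bound, so
positions can be traded for thresholds. -/
theorem mem_cuts_map_iff (d : ℕ → ℕ) {s : List ℕ} (hs : s.Pairwise (· < ·)) {p : ℕ} :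
    p ∈ cuts (s.map d) ↔ ∃ v, ((s.filter (· < v)).map d).sum = p := by
  induction s generalizing p with
  | nil => simp [cuts, eq_comm]
  | cons a s ih =>
    rw [List.pairwise_cons] at hs
    rw [List.map_cons, mem_cuts_cons]
    constructor
    · rintro (rfl | ⟨q, hq, rfl⟩)
      · exact ⟨0, by simp⟩
      · obtain ⟨v, rfl⟩ := (ih hs.2).1 hq
        -- This threshold lets `a` through and changes nothing for the later entries, all greater
        -- than `a`.
        refine ⟨max v (a + 1), ?_⟩
        rw [List.filter_cons_of_pos (by simp), List.map_cons, List.sum_cons]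
        congr 3
        refine List.filter_congr fun x hx => ?_
        have := hs.1 x hx
        rw [decide_eq_decide]
        omega
    · rintro ⟨v, rfl⟩
      by_cases hv : a < v
      · right
        rw [List.filter_cons_of_pos (by simpa using hv), List.map_cons, List.sum_cons]
        exact ⟨_, (ih hs.2).2 ⟨v, rfl⟩, rfl⟩
      · left
        rw [List.filter_eq_nil_iff.2]
        · rfl
        · intro x hx
          rcases List.mem_cons.1 hx with rfl | hx
          · simpa using hv
          · have := hs.1 x hx
            simp only [decide_eq_true_eq]
            omega

theorem mem_cuts_exponentWord (d : ℕ →₀ ℕ) {p : ℕ} :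
    p ∈ cuts (exponentWord d) ↔ ∃ v, ∑ u ∈ Finset.range v, d u = p := by
  rw [exponentWord, mem_cuts_map_iff d (Finset.sortedLT_sort _).pairwise]
  refine exists_congr fun v => ?_
  have h : ((d.support.sort (· ≤ ·)).filter (· < v)).toFinset = d.support.filter (· < v) := by
    ext x
    simp
  rw [← List.sum_toFinset d ((Finset.sort_nodup _ _).filter _), h]
  rw [Finset.sum_subset (s₂ := Finset.range v)]
  · intro x hx
    simp_all
  · intro x hx hx'
    simp_all

/-! ### The content of a function -/

/-- The exponent vector of the monomial `∏ i, x_{f i}`. -/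
noncomputable def content {n : ℕ} (f : Fin n → ℕ) : ℕ →₀ ℕ :=
  ∑ i, Finsupp.single (f i) 1

theorem content_apply {n : ℕ} (f : Fin n → ℕ) (v : ℕ) :
    content f v = (Finset.univ.filter fun i => f i = v).card := by
  rw [content, Finsupp.finsetSum_apply, Finset.card_filter]
  simp [Finsupp.single_apply]

theorem degree_content {n : ℕ} (f : Fin n → ℕ) : (content f).degree = n := by
  simp [content, map_sum]

theorem mem_support_content {n : ℕ} (f : Fin n → ℕ) (i : Fin n) : f i ∈ (content f).support := by
  rw [Finsupp.mem_support_iff, content_apply]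
  exact Finset.card_ne_zero_of_mem (a := i) (by simp)

theorem content_append {a m : ℕ} (f : Fin a → ℕ) (g : Fin m → ℕ) :
    content (Fin.append f g) = content f + content g := by
  simp [content, Fin.sum_univ_add]

theorem content_comp_perm {n : ℕ} (f : Fin n → ℕ) (σ : Equiv.Perm (Fin n)) :
    content (f ∘ σ) = content f :=
  Equiv.sum_comp σ fun i => Finsupp.single (f i) 1

theorem sum_range_content {n : ℕ} (f : Fin n → ℕ) (v : ℕ) :
    ∑ u ∈ Finset.range v, content f u = (Finset.univ.filter fun i => f i < v).card := by
  rw [Finset.card_eq_sum_card_fiberwise (f := f) (t := Finset.range v)]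
  · refine Finset.sum_congr rfl fun u hu => ?_
    rw [content_apply, Finset.filter_filter]
    congr 1
    ext i
    simp only [Finset.mem_filter, Finset.mem_univ, true_and, Finset.mem_range] at *
    omega
  · intro i hi
    simpa using hi

theorem toMultiset_content {n : ℕ} (f : Fin n → ℕ) :
    Finsupp.toMultiset (content f) = (List.ofFn f : Multiset ℕ) := by
  rw [content, map_sum]
  simp only [Finsupp.toMultiset_single, one_smul, Finset.sum, List.ofFn_eq_map, ← Multiset.map_coe,
    Fin.univ_def]
  rw [← Multiset.sum_map_singleton (Multiset.map f _), Multiset.map_map]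
  rfl

theorem eq_of_monotone_of_content_eq {n : ℕ} {f g : Fin n → ℕ} (hf : Monotone f)
    (hg : Monotone g) (h : content f = content g) : f = g := by
  have h1 := congrArg Finsupp.toMultiset h
  rw [toMultiset_content, toMultiset_content, Multiset.coe_eq_coe] at h1
  apply List.ofFn_injective
  exact h1.eq_of_pairwise' hf.sortedLE_ofFn.pairwise hg.sortedLE_ofFn.pairwise

/-- With `eq_of_monotone_of_content_eq`: a monomial of degree `n` has exactly one weakly increasing
list of variables. -/
theorem exists_monotone_content_eq {n : ℕ} {d : ℕ →₀ ℕ} (hd : d.degree = n) :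
    ∃ f : Fin n → ℕ, Monotone f ∧ content f = d := by
  have hl : ((Finsupp.toMultiset d).sort (· ≤ ·)).length = n := by
    rw [Multiset.length_sort, Finsupp.card_toMultiset, ← hd]
    rfl
  subst hl
  refine ⟨((Finsupp.toMultiset d).sort (· ≤ ·)).get, ?_, ?_⟩
  · exact (Multiset.pairwise_sort _ _).sortedLE.monotone_get
  · apply Multiset.toFinsupp.symm.injective
    change Finsupp.toMultiset _ = Finsupp.toMultiset _
    rw [toMultiset_content, List.ofFn_get, Multiset.sort_eq]

/-- The positions where a monotone `f` is below `v` form an initial segment, whose length is a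
partial sum of the exponents. A jump after position `i` means that one of these segments has length
`i + 1`. -/
theorem lt_succ_iff_mem_cuts_exponentWord {n : ℕ} {f : Fin n → ℕ} (hf : Monotone f) {i : ℕ}
    (hi : i + 1 < n) :
    f ⟨i, by omega⟩ < f ⟨i + 1, hi⟩ ↔ i + 1 ∈ cuts (exponentWord (content f)) := by
  rw [mem_cuts_exponentWord]
  simp only [sum_range_content]
  constructor
  · intro h
    refine ⟨f ⟨i + 1, hi⟩, ?_⟩
    have : (Finset.univ.filter fun j => f j < f ⟨i + 1, hi⟩) = Finset.Iio ⟨i + 1, hi⟩ := by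
      ext j
      simp only [Finset.mem_filter, Finset.mem_univ, true_and, Finset.mem_Iio]
      refine ⟨fun hj => hf.reflect_lt hj, fun hj => (hf ?_).trans_lt h⟩
      rw [Fin.lt_def] at hj
      rw [Fin.le_def]
      simp only at *
      omega
    rw [this, Fin.card_Iio]
  · rintro ⟨v, hv⟩
    -- Without a jump, the segment below `v` contains the first `i + 2` positions or lies within the
    -- first `i`, so its length is not `i + 1`.
    by_contra! h
    rcases lt_or_ge (f ⟨i, by omega⟩) v with h1 | h1
    · have : Finset.Iic (⟨i + 1, hi⟩ : Fin n) ⊆ Finset.univ.filter fun j => f j < v := by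
        intro j hj
        simp only [Finset.mem_filter, Finset.mem_univ, true_and, Finset.mem_Iic] at *
        exact (hf hj).trans_lt (h.trans_lt h1)
      have := Finset.card_le_card this
      rw [Fin.card_Iic] at this
      simp only at this
      omega
    · have : (Finset.univ.filter fun j => f j < v) ⊆ Finset.Iio (⟨i, by omega⟩ : Fin n) := by
        intro j hj
        simp only [Finset.mem_filter, Finset.mem_univ, true_and, Finset.mem_Iio] at *
        exact hf.reflect_lt (hj.trans_le h1)
      have := Finset.card_le_card this
      rw [Fin.card_Iio] at this
      simp only at this
      omega

/-! ### Generating functions of words -/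

/-- The functions `f` on positions for which the pairs `(f i, w i)` increase strictly in the
lexicographic order at every step that does not belong to the set `R` of breaks. -/
def Compatible (n : ℕ) (w : ℕ → ℕ) (R : Set ℕ) (f : Fin n → ℕ) : Prop :=
  ∀ (i : ℕ) (h : i + 1 < n), i + 1 ∉ R →
    toLex (f ⟨i, by omega⟩, w i) < toLex (f ⟨i + 1, h⟩, w (i + 1))

open Classical in
/-- The compatible functions with a given content. -/
noncomputable def compatibleFinset (n : ℕ) (w : ℕ → ℕ) (R : Set ℕ) (d : ℕ →₀ ℕ) :
    Finset (Fin n → ℕ) :=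
  (Fintype.piFinset fun _ => d.support).filter fun f => Compatible n w R f ∧ content f = d

theorem mem_compatibleFinset {n : ℕ} {w : ℕ → ℕ} {R : Set ℕ} {d : ℕ →₀ ℕ} {f : Fin n → ℕ} :
    f ∈ compatibleFinset n w R d ↔ Compatible n w R f ∧ content f = d := by
  classical
  refine Finset.mem_filter.trans (and_iff_right_iff_imp.2 ?_)
  rintro ⟨-, rfl⟩
  exact Fintype.mem_piFinset.2 (mem_support_content f)

/-- The generating function `∑ ∏ i, x_{f i}` of the compatible functions. -/
noncomputable def compatibleSeries (n : ℕ) (w : ℕ → ℕ) (R : Set ℕ) : MvPowerSeries ℕ ℚ :=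
  fun d => ((compatibleFinset n w R d).card : ℚ)

theorem coeff_compatibleSeries (n : ℕ) (w : ℕ → ℕ) (R : Set ℕ) (d : ℕ →₀ ℕ) :
    MvPowerSeries.coeff d (compatibleSeries n w R) = ((compatibleFinset n w R d).card : ℚ) :=
  rfl

/-- Every descent of the word `w 0, …, w (n - 1)` is a partial sum of the list `l`. -/
def DescentsIn (n : ℕ) (w : ℕ → ℕ) (l : List ℕ) : Prop :=
  ∀ i, i + 1 < n → w (i + 1) ≤ w i → i + 1 ∈ cuts l

open Classical in
/-- The fundamental quasisymmetric function of the word `w 0, …, w (n - 1)`. -/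
noncomputable def wordQ (n : ℕ) (w : ℕ → ℕ) : QSym :=
  ∑ β : Composition n with DescentsIn n w β.blocks, monomialQ β

/-- For a weakly increasing `f`, the lexicographic condition asks for a strict increase exactly
where `w` does not increase. -/
theorem compatible_iff_descentsIn {n : ℕ} {w : ℕ → ℕ} {f : Fin n → ℕ} (hf : Monotone f) :
    Compatible n w ∅ f ↔ DescentsIn n w (exponentWord (content f)) := by
  refine forall_congr' fun i => forall_congr' fun hi => ?_
  rw [← lt_succ_iff_mem_cuts_exponentWord hf hi, Prod.Lex.toLex_lt_toLex]
  have : f ⟨i, by omega⟩ ≤ f ⟨i + 1, hi⟩ := hf (by simp [Fin.le_def])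
  simp only [Set.mem_empty_iff_false, not_false_eq_true, true_imp_iff]
  omega

theorem Compatible.monotone {n : ℕ} {w : ℕ → ℕ} {f : Fin n → ℕ} (h : Compatible n w ∅ f) :
    Monotone f := by
  cases n with
  | zero => exact fun i => i.elim0
  | succ n =>
    refine Fin.monotone_iff_le_succ.2 fun i => ?_
    have := h i (by omega) (by simp)
    rw [Prod.Lex.toLex_lt_toLex] at this
    exact this.elim le_of_lt fun h => h.1.le

/-- This is the P-partition form of a fundamental function. With no breaks, a compatible function is
weakly increasing and hence determined by its content, so both sides have coefficients zero or one.
-/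
theorem coe_wordQ (n : ℕ) (w : ℕ → ℕ) :
    (wordQ n w : MvPowerSeries ℕ ℚ) = compatibleSeries n w ∅ := by
  classical
  ext d
  rw [coeff_compatibleSeries, wordQ, AddSubmonoidClass.coe_finsetSum, map_sum]
  change ∑ β : Composition n with DescentsIn n w β.blocks,
    MvPowerSeries.coeff d (monomialSeries β) = _
  simp only [coeff_monomialSeries]
  by_cases hd : d.degree = n
  · obtain ⟨f, hf, rfl⟩ := exists_monotone_content_eq hd
    have hsub : ∀ g ∈ compatibleFinset n w ∅ (content f), g = f := fun g hg =>
      eq_of_monotone_of_content_eq (mem_compatibleFinset.1 hg).1.monotone hf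
        (mem_compatibleFinset.1 hg).2
    have hblocks (β : Composition n) : exponentWord (content f) = β.blocks ↔
        (exponentComposition (content f)).cast hd = β := by
      rw [Composition.ext_iff]
      rfl
    have hw : ((exponentComposition (content f)).cast hd).blocks = exponentWord (content f) := rfl
    simp only [hblocks, Finset.sum_ite_eq, Finset.mem_filter, Finset.mem_univ, true_and, hw,
      ← compatible_iff_descentsIn hf]
    split_ifs with h
    · have : compatibleFinset n w ∅ (content f) = {f} :=
        Finset.eq_singleton_iff_unique_mem.2 ⟨mem_compatibleFinset.2 ⟨h, rfl⟩, hsub⟩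
      simp [this]
    · have : compatibleFinset n w ∅ (content f) = ∅ := by
        refine Finset.eq_empty_iff_forall_notMem.2 fun g hg => h ?_
        rw [← hsub g hg]
        exact (mem_compatibleFinset.1 hg).1
      simp [this]
  · rw [Finset.sum_eq_zero]
    · have : compatibleFinset n w ∅ d = ∅ := by
        refine Finset.eq_empty_iff_forall_notMem.2 fun g hg => hd ?_
        rw [← (mem_compatibleFinset.1 hg).2, degree_content]
      simp [this]
    · intro β _
      rw [if_neg]
      intro h
      apply hd
      rw [← sum_exponentWord, h, β.blocks_sum]

/-! ### Products of generating functions -/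

/-- The first part `a` is itself a break, so nothing is required at the junction; the other breaks
shift by `a`. -/
theorem compatible_append {a m : ℕ} {w : ℕ → ℕ} {l : List ℕ} {f : Fin a → ℕ} {g : Fin m → ℕ} :
    Compatible (a + m) w (cuts (a :: l)) (Fin.append f g) ↔
      Compatible a w ∅ f ∧ Compatible m (fun i => w (a + i)) (cuts l) g := by
  have hl (i : ℕ) (h : i < a) (h' : i < a + m) : Fin.append f g ⟨i, h'⟩ = f ⟨i, h⟩ :=
    Fin.append_left f g ⟨i, h⟩
  have hr (i : ℕ) (h : i < m) (h' : a + i < a + m) : Fin.append f g ⟨a + i, h'⟩ = g ⟨i, h⟩ :=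
    Fin.append_right f g ⟨i, h⟩
  constructor
  · refine fun H => ⟨fun i hi _ => ?_, fun i hi hi' => ?_⟩
    · have := H i (by omega) ?_
      · rwa [hl i (by omega), hl (i + 1) hi] at this
      · rw [mem_cuts_cons]
        rintro (h | ⟨q, -, h⟩) <;> omega
    · have := H (a + i) (by omega) ?_
      · rw [hr i (by omega)] at this
        exact this.trans_eq (congrArg (fun x => toLex (x, w (a + i + 1))) (hr (i + 1) hi _))
      · rw [mem_cuts_cons]
        rintro (h | ⟨q, hq, h⟩)
        · omega
        · apply hi'
          rwa [show i + 1 = q by omega]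
  · rintro ⟨H1, H2⟩ i hi hi'
    rw [mem_cuts_cons, not_or] at hi'
    have ha : i + 1 ≠ a := fun h => hi'.2 ⟨0, zero_mem_cuts l, by omega⟩
    rcases lt_or_gt_of_ne ha with h | h
    · rw [hl i (by omega), hl (i + 1) h]
      exact H1 i h (by simp)
    · obtain ⟨j, rfl⟩ := Nat.exists_eq_add_of_le (show a ≤ i by omega)
      rw [hr j (by omega)]
      refine (H2 j (by omega) fun hj => hi'.2 ⟨j + 1, hj, by omega⟩).trans_eq ?_
      exact (congrArg (fun x => toLex (x, w (a + j + 1))) (hr (j + 1) (by omega) _)).symm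

/-- Cutting a function at position `a` is a bijection onto pairs, and content is additive. -/
theorem compatibleSeries_cons (a m : ℕ) (w : ℕ → ℕ) (l : List ℕ) :
    compatibleSeries (a + m) w (cuts (a :: l)) =
      compatibleSeries a w ∅ * compatibleSeries m (fun i => w (a + i)) (cuts l) := by
  classical
  ext d
  rw [MvPowerSeries.coeff_mul]
  simp only [coeff_compatibleSeries, ← Nat.cast_mul, ← Nat.cast_sum, ← Finset.card_product]
  rw [← Finset.card_sigma]
  congr 1
  symm
  refine Finset.card_bij (fun x _ => Fin.append x.2.1 x.2.2) ?_ ?_ ?_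
  · rintro ⟨⟨d₁, d₂⟩, f, g⟩ hx
    simp only [Finset.mem_sigma, Finset.HasAntidiagonal.mem_antidiagonal, Finset.mem_product,
      mem_compatibleFinset] at hx
    obtain ⟨hd, ⟨hf, rfl⟩, hg, rfl⟩ := hx
    exact mem_compatibleFinset.2 ⟨compatible_append.2 ⟨hf, hg⟩, by rw [content_append, hd]⟩
  · rintro ⟨⟨d₁, d₂⟩, f, g⟩ hx ⟨⟨d₁', d₂'⟩, f', g'⟩ hx' h
    simp only [Finset.mem_sigma, Finset.HasAntidiagonal.mem_antidiagonal, Finset.mem_product,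
      mem_compatibleFinset] at hx hx'
    obtain ⟨-, ⟨-, rfl⟩, -, rfl⟩ := hx
    obtain ⟨-, ⟨-, rfl⟩, -, rfl⟩ := hx'
    obtain ⟨rfl, rfl⟩ := Prod.mk.inj ((Fin.appendEquiv a m).injective (a₁ := (f, g))
      (a₂ := (f', g')) h)
    rfl
  · intro h hh
    obtain ⟨⟨f, g⟩, rfl⟩ := (Fin.appendEquiv a m).surjective h
    obtain ⟨h1, h2⟩ := mem_compatibleFinset.1 hh
    obtain ⟨hf, hg⟩ := compatible_append.1 h1
    refine ⟨⟨(content f, content g), f, g⟩, ?_, rfl⟩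
    simp only [Finset.mem_sigma, Finset.HasAntidiagonal.mem_antidiagonal, Finset.mem_product,
      mem_compatibleFinset, and_true]
    exact ⟨(content_append f g).symm.trans h2, hf, hg⟩

/-- The product of the fundamental quasisymmetric functions of the consecutive segments of the
word `w` whose lengths are listed. -/
noncomputable def segmentsQ (w : ℕ → ℕ) : List ℕ → QSym
  | [] => 1
  | a :: l => wordQ a w * segmentsQ (fun i => w (a + i)) l

theorem coe_segmentsQ (w : ℕ → ℕ) (l : List ℕ) :
    (segmentsQ w l : MvPowerSeries ℕ ℚ) = compatibleSeries l.sum w (cuts l) := by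
  induction l generalizing w with
  | nil =>
    classical
    ext d
    change MvPowerSeries.coeff d (1 : MvPowerSeries ℕ ℚ) = _
    rw [coeff_compatibleSeries, MvPowerSeries.coeff_one, List.sum_nil]
    have hc (f : Fin 0 → ℕ) : content f = 0 := by simp [content]
    split_ifs with h
    · have : compatibleFinset 0 w (cuts []) d = {Fin.elim0} := by
        refine Finset.eq_singleton_iff_unique_mem.2 ⟨mem_compatibleFinset.2 ⟨?_, ?_⟩, ?_⟩
        · intro i hi
          omega
        · rw [hc, h]
        · exact fun f _ => Subsingleton.elim _ _
      simp [this]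
    · have : compatibleFinset 0 w (cuts []) d = ∅ := by
        refine Finset.eq_empty_iff_forall_notMem.2 fun g hg => h ?_
        rw [← (mem_compatibleFinset.1 hg).2, hc]
      simp [this]
  | cons a l ih =>
    rw [segmentsQ, MulMemClass.coe_mul, coe_wordQ, ih, List.sum_cons, compatibleSeries_cons]

/-! ### Sorting -/

/-- The word of a permutation. -/
def permWord {n : ℕ} (σ : Equiv.Perm (Fin n)) (i : ℕ) : ℕ :=
  if h : i < n then σ ⟨i, h⟩ else 0

theorem permWord_val {n : ℕ} (σ : Equiv.Perm (Fin n)) (i : Fin n) : permWord σ i = σ i := by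
  simp [permWord]

/-- All descents of a permutation belong to `R`. -/
def PermDescentsIn {n : ℕ} (σ : Equiv.Perm (Fin n)) (R : Set ℕ) : Prop :=
  ∀ (i : ℕ) (h : i + 1 < n), i + 1 ∉ R → σ ⟨i, by omega⟩ < σ ⟨i + 1, h⟩

/-- The pairs `(f i, π i)` in lexicographic order. -/
def lexPair {n : ℕ} (π : Equiv.Perm (Fin n)) (f : Fin n → ℕ) (i : Fin n) : ℕ ×ₗ Fin n :=
  toLex (f i, π i)

theorem lexPair_injective {n : ℕ} (π : Equiv.Perm (Fin n)) (f : Fin n → ℕ) :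
    Function.Injective (lexPair π f) := fun _ _ h =>
  π.injective (congrArg (fun x => (ofLex x).2) h)

theorem compatible_permWord {n : ℕ} {π : Equiv.Perm (Fin n)} {R : Set ℕ} {f : Fin n → ℕ} :
    Compatible n (permWord π) R f ↔ ∀ (i : ℕ) (h : i + 1 < n), i + 1 ∉ R →
      lexPair π f ⟨i, by omega⟩ < lexPair π f ⟨i + 1, h⟩ := by
  refine forall_congr' fun i => forall_congr' fun hi => imp_congr_right fun _ => ?_
  have h1 : permWord π i = π ⟨i, by omega⟩ := permWord_val π ⟨i, by omega⟩
  have h2 : permWord π (i + 1) = π ⟨i + 1, hi⟩ := permWord_val π ⟨i + 1, hi⟩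
  rw [lexPair, lexPair, Prod.Lex.toLex_lt_toLex, Prod.Lex.toLex_lt_toLex, h1, h2, Fin.lt_def]

theorem compatible_permWord_empty {n : ℕ} {π : Equiv.Perm (Fin n)} {f : Fin n → ℕ} :
    Compatible n (permWord π) ∅ f ↔ StrictMono (lexPair π f) := by
  rw [compatible_permWord]
  cases n with
  | zero => exact ⟨fun _ i => i.elim0, fun _ i h => by omega⟩
  | succ n =>
    rw [Fin.strictMono_iff_lt_succ]
    exact ⟨fun h i => h i (by omega) (by simp), fun h i hi _ => h ⟨i, by omega⟩⟩

theorem lexPair_comp {n : ℕ} (π τ : Equiv.Perm (Fin n)) (f : Fin n → ℕ) :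
    lexPair (π * τ) (f ∘ τ) = lexPair π f ∘ τ := rfl

/-- Since `lexPair (π * τ⁻¹) g` is strictly increasing, its composite with `τ` rises exactly where
`τ` does. -/
theorem compatible_comp {n : ℕ} {π τ : Equiv.Perm (Fin n)} {R : Set ℕ} {g : Fin n → ℕ}
    (hg : Compatible n (permWord (π * τ⁻¹)) ∅ g) :
    Compatible n (permWord π) R (g ∘ τ) ↔ PermDescentsIn τ R := by
  have h : lexPair π (g ∘ τ) = lexPair (π * τ⁻¹) g ∘ τ := by
    rw [← lexPair_comp, inv_mul_cancel_right]
  rw [compatible_permWord_empty] at hg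
  simp only [compatible_permWord, h, Function.comp_apply, hg.lt_iff_lt, PermDescentsIn]

-- The pairs `(f i, π i)` are distinct, so exactly one permutation sorts them. With `τ` its inverse
-- and `g` the sorted function, `f = g ∘ τ`. The condition on `f` becomes a condition on the
-- descents of `τ`, and `g` is compatible without breaks for the word of `π * τ⁻¹`.
open Classical in
theorem compatibleSeries_permWord {n : ℕ} (π : Equiv.Perm (Fin n)) (R : Set ℕ) :
    compatibleSeries n (permWord π) R =
      ∑ τ : Equiv.Perm (Fin n) with PermDescentsIn τ R,
        compatibleSeries n (permWord (π * τ⁻¹)) ∅ := by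
  ext d
  rw [map_sum]
  simp only [coeff_compatibleSeries, ← Nat.cast_sum]
  rw [← Finset.card_sigma]
  congr 1
  symm
  refine Finset.card_bij (fun x _ => x.2 ∘ x.1) ?_ ?_ ?_
  · rintro ⟨τ, g⟩ hx
    simp only [Finset.mem_sigma, Finset.mem_filter, Finset.mem_univ, true_and,
      mem_compatibleFinset] at hx
    obtain ⟨hτ, hg, rfl⟩ := hx
    exact mem_compatibleFinset.2 ⟨(compatible_comp hg).2 hτ, content_comp_perm g τ⟩
  · rintro ⟨τ, g⟩ hx ⟨τ', g'⟩ hx' h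
    simp only [Finset.mem_sigma, Finset.mem_filter, Finset.mem_univ, true_and,
      mem_compatibleFinset, compatible_permWord_empty] at hx hx' h
    have h1 : lexPair (π * τ⁻¹) g = lexPair π (g ∘ τ) ∘ ⇑τ⁻¹ := by
      rw [← lexPair_comp]
      congr 1
      ext i
      simp
    have h2 : lexPair (π * τ'⁻¹) g' = lexPair π (g ∘ τ) ∘ ⇑τ'⁻¹ := by
      rw [h, ← lexPair_comp]
      congr 1
      ext i
      simp
    -- Two increasing enumerations of the same set of pairs coincide.
    have h3 : lexPair π (g ∘ τ) ∘ ⇑τ⁻¹ = lexPair π (g ∘ τ) ∘ ⇑τ'⁻¹ := by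
      refine (StrictMono.range_inj (h1 ▸ hx.2.1) (h2 ▸ hx'.2.1)).1 ?_
      rw [τ⁻¹.surjective.range_comp, τ'⁻¹.surjective.range_comp]
    have h4 : τ = τ' := inv_injective
      (DFunLike.coe_injective ((lexPair_injective π (g ∘ τ)).comp_left h3))
    subst h4
    rw [τ.surjective.injective_comp_right h]
  · intro f hf
    obtain ⟨hfc, rfl⟩ := mem_compatibleFinset.1 hf
    have hs : Compatible n (permWord (π * (Tuple.sort (lexPair π f))⁻¹⁻¹)) ∅
        (f ∘ Tuple.sort (lexPair π f)) := by
      rw [compatible_permWord_empty, inv_inv, lexPair_comp]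
      exact (Tuple.monotone_sort _).strictMono_of_injective
        ((lexPair_injective π f).comp (Equiv.injective _))
    have hcomp : (f ∘ Tuple.sort (lexPair π f)) ∘ ⇑(Tuple.sort (lexPair π f))⁻¹ = f := by
      ext i
      simp
    refine ⟨⟨(Tuple.sort (lexPair π f))⁻¹, f ∘ Tuple.sort (lexPair π f)⟩, ?_, hcomp⟩
    simp only [Finset.mem_sigma, Finset.mem_filter, Finset.mem_univ, true_and,
      mem_compatibleFinset]
    exact ⟨(compatible_comp hs).1 (hcomp.symm ▸ hfc), hs, content_comp_perm _ _⟩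

open Classical in
/-- The product of the fundamental quasisymmetric functions of the segments of a permutation is
the sum of those of all shuffles of the segments. -/
theorem segmentsQ_permWord {n : ℕ} (π : Equiv.Perm (Fin n)) (γ : Composition n) :
    segmentsQ (permWord π) γ.blocks =
      ∑ τ : Equiv.Perm (Fin n) with PermDescentsIn τ (cuts γ.blocks),
        wordQ n (permWord (π * τ⁻¹)) := by
  apply Subtype.ext
  rw [coe_segmentsQ, γ.blocks_sum, compatibleSeries_permWord, AddSubmonoidClass.coe_finsetSum]
  simp only [coe_wordQ]

/-! ### Coefficients of monomial quasisymmetric functions -/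

/-- The coefficient of the monomial quasisymmetric function with the given list of parts. -/
noncomputable def monomialCoeff (l : List ℕ) : QSym →ₗ[ℚ] ℚ :=
  monomialBasis.constr ℚ fun p => if p.2.blocks = l then 1 else 0

theorem monomialCoeff_monomialQ (l : List ℕ) {n : ℕ} (α : Composition n) :
    monomialCoeff l (monomialQ α) = if α.blocks = l then 1 else 0 := by
  have := monomialBasis.constr_basis ℚ (fun p : Σ n, Composition n =>
    if p.2.blocks = l then (1 : ℚ) else 0) ⟨n, α⟩
  rw [monomialBasis_apply] at this
  exact this

theorem monomialCoeff_fundamentalQ {n : ℕ} (β γ : Composition n) :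
    monomialCoeff γ.blocks (fundamentalQ β) =
      if partialSums n β ⊆ partialSums n γ then 1 else 0 := by
  simp only [fundamentalQ, map_sum, monomialCoeff_monomialQ, ← Composition.ext_iff]
  rw [Finset.sum_ite_eq']
  simp

theorem linearMap_ext_monomialQ {V : Type*} [AddCommMonoid V] [Module ℚ V] {φ ψ : QSym →ₗ[ℚ] V}
    (h : ∀ (n : ℕ) (α : Composition n), φ (monomialQ α) = ψ (monomialQ α)) : φ = ψ :=
  monomialBasis.ext fun p => by simpa using h p.1 p.2

theorem exponentWord_single (n : ℕ) : exponentWord (Finsupp.single 0 n) = (onePart n).blocks := by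
  cases n with
  | zero => simp [exponentWord, onePart]
  | succ n =>
    rw [exponentWord, Finsupp.support_single _ n.succ_ne_zero]
    simp [onePart]

/-- Among all `M_α`, only that of the one-part composition contains this power of the single
variable `x₀`. -/
theorem monomialCoeff_onePart (n : ℕ) (f : QSym) :
    monomialCoeff (onePart n).blocks f =
      MvPowerSeries.coeff (Finsupp.single 0 n) (f : MvPowerSeries ℕ ℚ) := by
  have h : monomialCoeff (onePart n).blocks =
      (MvPowerSeries.coeff (Finsupp.single 0 n)).comp QSym.val.toLinearMap := by
    refine linearMap_ext_monomialQ fun m α => ?_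
    rw [monomialCoeff_monomialQ]
    change _ = MvPowerSeries.coeff (Finsupp.single 0 n) (monomialSeries α)
    rw [coeff_monomialSeries, exponentWord_single]
    simp only [eq_comm]
  rw [h]
  rfl

theorem monomialCoeff_eq_zero {l : List ℕ} {n : ℕ} (h : n ≠ l.sum) {f : QSym}
    (hf : f ∈ homogeneous n) : monomialCoeff l f = 0 := by
  induction hf using Submodule.span_induction with
  | mem x hx =>
    obtain ⟨α, rfl⟩ := hx
    rw [monomialCoeff_monomialQ, if_neg]
    rintro rfl
    exact h α.blocks_sum.symm
  | zero => simp
  | add x y _ _ hx hy => rw [map_add, hx, hy, add_zero]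
  | smul a x _ hx => rw [map_smul, hx, smul_zero]

theorem coeff_eq_zero_of_mem_homogeneous {n : ℕ} {f : QSym} (hf : f ∈ homogeneous n)
    {d : ℕ →₀ ℕ} (hd : d.degree ≠ n) : MvPowerSeries.coeff d (f : MvPowerSeries ℕ ℚ) = 0 := by
  induction hf using Submodule.span_induction with
  | mem x hx =>
    obtain ⟨α, rfl⟩ := hx
    change MvPowerSeries.coeff d (monomialSeries α) = 0
    rw [coeff_monomialSeries, if_neg]
    intro h
    rw [← sum_exponentWord, h, α.blocks_sum] at hd
    exact hd rfl
  | zero => simp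
  | add x y _ _ hx hy => rw [AddMemClass.coe_add, map_add, hx, hy, add_zero]
  | smul a x _ hx =>
    change MvPowerSeries.coeff d (a • (x : MvPowerSeries ℕ ℚ)) = 0
    rw [map_smul, hx, smul_zero]

/-- A power of `x₀` factors only into powers of `x₀`, and homogeneity of `f` fixes the two
exponents. -/
theorem coeff_single_mul {a : ℕ} {f : QSym} (hf : f ∈ homogeneous a) (m : ℕ) (g : QSym) :
    MvPowerSeries.coeff (Finsupp.single 0 (a + m)) ((f * g : QSym) : MvPowerSeries ℕ ℚ) =
      MvPowerSeries.coeff (Finsupp.single 0 a) (f : MvPowerSeries ℕ ℚ) *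
        MvPowerSeries.coeff (Finsupp.single 0 m) (g : MvPowerSeries ℕ ℚ) := by
  rw [MulMemClass.coe_mul, MvPowerSeries.coeff_mul, Finsupp.antidiagonal_single, Finset.sum_map,
    Finset.sum_eq_single (a, m)]
  · rfl
  · rintro ⟨i, j⟩ hij hne
    rw [Finset.HasAntidiagonal.mem_antidiagonal] at hij
    have : i ≠ a := by
      rintro rfl
      apply hne
      rw [Prod.mk.injEq]
      simp only at hij
      omega
    refine mul_eq_zero_of_left (coeff_eq_zero_of_mem_homogeneous hf ?_) _
    simpa using this
  · intro h
    simp at h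

/-! ### Coproducts -/

/-- The product of two functionals on the two tensor factors. -/
noncomputable def tensorEval (φ ψ : QSym →ₗ[ℚ] ℚ) : QSym ⊗[ℚ] QSym →ₗ[ℚ] ℚ :=
  LinearMap.mul' ℚ ℚ ∘ₗ TensorProduct.map φ ψ

theorem tensorEval_tmul (φ ψ : QSym →ₗ[ℚ] ℚ) (x y : QSym) :
    tensorEval φ ψ (x ⊗ₜ y) = φ x * ψ y := rfl

theorem monomialQ_congr {m n : ℕ} {α : Composition m} {β : Composition n}
    (h : α.blocks = β.blocks) : monomialQ α = monomialQ β := by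
  apply Subtype.ext
  ext d
  change MvPowerSeries.coeff d (monomialSeries α) = MvPowerSeries.coeff d (monomialSeries β)
  rw [coeff_monomialSeries, coeff_monomialSeries, h]

/-- Only the deconcatenation after the first part can have `[a]` as its left factor. -/
theorem monomialCoeff_cons (a : ℕ) (l : List ℕ) :
    tensorEval (monomialCoeff [a]) (monomialCoeff l) ∘ₗ CoalgebraStruct.comul =
      monomialCoeff (a :: l) := by
  refine linearMap_ext_monomialQ fun n β => ?_
  simp only [LinearMap.comp_apply, comul_monomialQ, map_sum, tensorEval_tmul,
    monomialCoeff_monomialQ, takeParts, dropParts]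
  by_cases h : β.blocks = a :: l
  · rw [if_pos h, Finset.sum_eq_single 1]
    · simp [h]
    · intro k _ hk
      rw [if_neg, zero_mul]
      rw [h]
      intro hc
      have hlen := congrArg List.length hc
      rcases k with _ | k
      · simp at hlen
      · rw [List.take_succ_cons, List.cons.injEq] at hc
        have hl : β.length = l.length + 1 := by rw [← β.blocks_length, h, List.length_cons]
        simp only [List.take_succ_cons, List.length_cons, List.length_take, List.length_nil] at hlen
        simp_all
    · intro hc
      rw [Finset.mem_range, not_lt, ← β.blocks_length, h] at hc
      simp at hc
  · rw [if_neg h]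
    refine Finset.sum_eq_zero fun k _ => ?_
    split_ifs with h1 h2
    · exfalso
      apply h
      rw [← List.take_append_drop k β.blocks, h1, h2, List.singleton_append]
    all_goals simp

theorem descentsIn_append {a m : ℕ} {w : ℕ → ℕ} {l l' : List ℕ} (hl : l.sum = a) :
    DescentsIn (a + m) w (l ++ l') ↔
      DescentsIn a w l ∧ DescentsIn m (fun i => w (a + i)) l' := by
  constructor
  · intro H
    refine ⟨fun i hi hw => ?_, fun i hi hw => ?_⟩
    · rcases mem_cuts_append.1 (H i (by omega) hw) with h | ⟨q, hq, h⟩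
      · exact h
      · omega
    · rcases mem_cuts_append.1 (H (a + i) (by omega) hw) with h | ⟨q, hq, h⟩
      · have := le_sum_of_mem_cuts h
        omega
      · rwa [show i + 1 = q by omega]
  · rintro ⟨H1, H2⟩ i hi hw
    rw [mem_cuts_append]
    rcases lt_or_ge (i + 1) a with h | h
    · exact Or.inl (H1 i h hw)
    · rcases Nat.lt_or_ge i a with h' | h'
      -- Here `i + 1 = a`: a descent at the junction is always allowed, as `a` is a partial sum of
      -- the concatenation.
      · exact Or.inr ⟨0, zero_mem_cuts _, by omega⟩
      · obtain ⟨j, rfl⟩ := Nat.exists_eq_add_of_le h'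
        exact Or.inr ⟨j + 1, H2 j (by omega) hw, by omega⟩

/-- The functional `φ` sees only left factors of degree `a`. The deconcatenations of this kind
correspond to pairs of compositions of `a` and `m`, and the descent condition splits accordingly. -/
theorem tensorEval_comul_wordQ {a m : ℕ} (w : ℕ → ℕ) {φ ψ : QSym →ₗ[ℚ] ℚ}
    (hφ : ∀ k ≠ a, ∀ f ∈ homogeneous k, φ f = 0) :
    tensorEval φ ψ (CoalgebraStruct.comul (wordQ (a + m) w)) =
      φ (wordQ a w) * ψ (wordQ m fun i => w (a + i)) := by
  classical
  simp only [wordQ, map_sum, comul_monomialQ, tensorEval_tmul]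
  rw [Finset.sum_mul_sum, ← Finset.sum_product', Finset.sum_sigma']
  symm
  refine Finset.sum_of_injOn
    (fun x : Composition a × Composition m => ⟨x.1.append x.2, x.1.length⟩) ?_ ?_ ?_ ?_
  · rintro ⟨β, γ⟩ - ⟨β', γ'⟩ - h
    simp only [Sigma.mk.injEq, heq_eq_eq, Composition.ext_iff] at h
    obtain ⟨h1, h2⟩ := List.append_inj h.1 h.2
    exact Prod.ext (Composition.ext h1) (Composition.ext h2)
  · rintro ⟨β, γ⟩ h
    simp only [Finset.coe_product, Finset.coe_filter, Finset.mem_univ, true_and, Set.mem_prod,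
      Set.mem_ofPred_eq] at h
    simp only [Finset.coe_sigma, Set.mem_sigma_iff, Finset.coe_filter, Finset.mem_univ, true_and,
      Set.mem_ofPred_eq, Finset.coe_range, Set.mem_Iio]
    refine ⟨(descentsIn_append β.blocks_sum).2 h, ?_⟩
    change _ < (β.blocks ++ γ.blocks).length + 1
    rw [List.length_append, ← β.blocks_length]
    omega
  · rintro ⟨β, k⟩ hβ h
    simp only [Finset.mem_sigma, Finset.mem_filter, Finset.mem_univ, true_and,
      Finset.mem_range] at hβ
    by_cases hk : (β.blocks.take k).sum = a
    · exfalso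
      apply h
      have hsum := β.blocks_sum
      have hd : (β.blocks.drop k).sum = m := by
        rw [← List.take_append_drop k β.blocks, List.sum_append] at hsum
        omega
      have hw := hβ.1
      rw [← List.take_append_drop k β.blocks, descentsIn_append hk] at hw
      refine ⟨((takeParts β k).cast hk, (dropParts β k).cast hd), ?_, ?_⟩
      · simp only [Finset.coe_product, Finset.coe_filter, Finset.mem_univ, true_and, Set.mem_prod,
          Set.mem_ofPred_eq]
        exact hw
      · simp only [Sigma.mk.injEq, heq_eq_eq, Composition.ext_iff]
        refine ⟨List.take_append_drop k β.blocks, ?_⟩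
        change (β.blocks.take k).length = k
        rw [List.length_take, β.blocks_length]
        omega
    · exact mul_eq_zero_of_left (hφ _ hk _ (monomialQ_mem _)) _
  · rintro ⟨β, γ⟩ -
    congr 2 <;> refine monomialQ_congr ?_
    · exact (List.take_left (l₁ := β.blocks) (l₂ := γ.blocks)).symm
    · exact (List.drop_left (l₁ := β.blocks) (l₂ := γ.blocks)).symm

theorem wordQ_mem (n : ℕ) (w : ℕ → ℕ) : wordQ n w ∈ homogeneous n :=
  Submodule.sum_mem _ fun β _ => monomialQ_mem β

theorem tensorEval_comul_apply (Φ : HopfEnd) (φ ψ : QSym →ₗ[ℚ] ℚ) (f : QSym) :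
    tensorEval φ ψ (CoalgebraStruct.comul (Φ.toBialgHom f)) =
      tensorEval (φ ∘ₗ (Φ.toBialgHom : QSym →ₗ[ℚ] QSym)) (ψ ∘ₗ (Φ.toBialgHom : QSym →ₗ[ℚ] QSym))
        (CoalgebraStruct.comul f) := by
  have h := CoalgHomClass.map_comp_comul_apply Φ.toBialgHom f
  rw [← h, tensorEval, tensorEval, TensorProduct.map_comp]
  rfl

theorem wordQ_zero (w : ℕ → ℕ) : wordQ 0 w = 1 := by
  change _ = segmentsQ w []
  apply Subtype.ext
  rw [coe_wordQ, coe_segmentsQ]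
  ext d
  rw [List.sum_nil, coeff_compatibleSeries, coeff_compatibleSeries]
  congr 2
  ext f
  simp [mem_compatibleFinset, Compatible]

/-- Induction on the parts: the coproduct splits off the first segment on the left, the product does
so on the right, and `Φ` respects both. -/
theorem monomialCoeff_apply_wordQ (Φ : HopfEnd) {l : List ℕ} (hl : ∀ a ∈ l, 0 < a) (w : ℕ → ℕ) :
    monomialCoeff l (Φ.toBialgHom (wordQ l.sum w)) =
      MvPowerSeries.coeff (Finsupp.single 0 l.sum)
        (Φ.toBialgHom (segmentsQ w l) : MvPowerSeries ℕ ℚ) := by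
  induction l generalizing w with
  | nil =>
    rw [List.sum_nil, wordQ_zero, segmentsQ]
    exact monomialCoeff_onePart 0 _
  | cons a l ih =>
    have ha : 0 < a := hl a List.mem_cons_self
    -- Positivity matters: `onePart 0` has no parts at all.
    have hone : (onePart a).blocks = [a] := by
      obtain ⟨b, rfl⟩ := Nat.exists_eq_succ_of_ne_zero ha.ne'
      simp [onePart]
    rw [← monomialCoeff_cons, LinearMap.comp_apply, tensorEval_comul_apply, List.sum_cons,
      tensorEval_comul_wordQ, segmentsQ, map_mul, coeff_single_mul]
    · rw [← ih (fun b hb => hl b (List.mem_cons_of_mem _ hb)), ← monomialCoeff_onePart, hone]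
      rfl
    · exact Φ.map_homogeneous a _ (wordQ_mem a w)
    · intro k hk f hf
      exact monomialCoeff_eq_zero (by simpa using hk) (Φ.map_homogeneous k f hf)

/-! ### Descents of permutations -/

theorem partialSums_descentComposition {n : ℕ} (σ : Equiv.Perm (Fin n)) :
    partialSums n (descentComposition σ) = descentSet σ := by
  simp [descentComposition]

theorem mem_descentSet {n : ℕ} (σ : Equiv.Perm (Fin n)) (i : Fin (n - 1)) :
    i ∈ descentSet σ ↔ σ ⟨i + 1, by omega⟩ < σ ⟨i, by omega⟩ := by
  simp [descentSet]

theorem fundamentalQ_descentComposition {n : ℕ} (σ : Equiv.Perm (Fin n)) :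
    fundamentalQ (descentComposition σ) = wordQ n (permWord σ) := by
  classical
  rw [fundamentalQ, wordQ]
  refine Finset.sum_congr (Finset.filter_congr fun β _ => ?_) fun _ _ => rfl
  rw [partialSums_descentComposition]
  have hw (i : ℕ) (hi : i + 1 < n) : permWord σ (i + 1) ≤ permWord σ i ↔
      σ ⟨i + 1, hi⟩ < σ ⟨i, by omega⟩ := by
    have h1 : permWord σ i = σ ⟨i, by omega⟩ := permWord_val σ ⟨i, by omega⟩
    have h2 : permWord σ (i + 1) = σ ⟨i + 1, hi⟩ := permWord_val σ ⟨i + 1, hi⟩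
    rw [h1, h2, ← Fin.le_def]
    refine ⟨fun h => lt_of_le_of_ne h fun hc => ?_, le_of_lt⟩
    have := congrArg Fin.val (σ.injective hc)
    simp at this
  constructor
  · intro h i hi hwi
    exact (mem_partialSums β ⟨i, by omega⟩).1 (h ((mem_descentSet σ _).2 ((hw i hi).1 hwi)))
  · intro h i hi
    rw [mem_partialSums]
    exact h i (by omega) ((hw i (by omega)).2 ((mem_descentSet σ i).1 hi))

theorem permDescentsIn_iff {n : ℕ} (τ : Equiv.Perm (Fin n)) (γ : Composition n) :
    PermDescentsIn τ (cuts γ.blocks) ↔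
      partialSums n (descentComposition τ) ⊆ partialSums n γ := by
  rw [partialSums_descentComposition]
  constructor
  · intro h i hi
    rw [mem_partialSums]
    by_contra hc
    exact lt_asymm (h i (by omega) hc) ((mem_descentSet τ i).1 hi)
  · intro h i hi hc
    have hi' : (⟨i, by omega⟩ : Fin (n - 1)) ∉ descentSet τ := fun hm =>
      hc ((mem_partialSums γ _).1 (h hm))
    rw [mem_descentSet, not_lt] at hi'
    refine lt_of_le_of_ne hi' fun hc => ?_
    have := congrArg Fin.val (τ.injective hc)
    simp at this

theorem partialSums_ones (n : ℕ) : partialSums n (Composition.ones n) = Finset.univ := by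
  refine Finset.eq_univ_iff_forall.2 fun i => ?_
  rw [mem_partialSums, mem_cuts_iff_exists_take, Composition.ones_blocks]
  refine ⟨i + 1, ?_, ?_⟩
  · rw [List.length_replicate]
    omega
  · rw [List.take_replicate, List.sum_replicate, smul_eq_mul, mul_one]
    omega

theorem exists_perm_lt_iff {n : ℕ} {α : Type*} [LinearOrder α] {h : Fin n → α}
    (hh : Function.Injective h) : ∃ σ : Equiv.Perm (Fin n), ∀ i j, σ i < σ j ↔ h i < h j := by
  have hm : StrictMono (h ∘ Tuple.sort h) :=
    (Tuple.monotone_sort h).strictMono_of_injective (hh.comp (Equiv.injective _))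
  refine ⟨(Tuple.sort h)⁻¹, fun i j => ?_⟩
  rw [← hm.lt_iff_lt]
  simp

theorem descentComposition_surjective (n : ℕ) :
    Function.Surjective (descentComposition : Equiv.Perm (Fin n) → Composition n) := by
  intro α
  -- `c` counts the cuts at or after `k`, so it drops exactly at the cuts. Ordering positions by
  -- `c`, with ties broken by position, gives descents exactly there.
  let c : ℕ → ℕ := fun k => ((partialSums n α).filter fun j : Fin (n - 1) => k ≤ (j : ℕ)).card
  obtain ⟨σ, hσ⟩ := exists_perm_lt_iff (h := fun i : Fin n => toLex (c i, i))
    fun i j h => congrArg (fun x => (ofLex x).2) h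
  refine ⟨σ, (partialSums n).injective ?_⟩
  rw [partialSums_descentComposition]
  ext i
  rw [mem_descentSet, hσ, Prod.Lex.toLex_lt_toLex]
  have hle : (c (i + 1) : ℕ) ≤ c i :=
    Finset.card_le_card (Finset.monotone_filter_right _ fun j _ hj => by omega)
  have hlt : ¬ ((⟨(i : ℕ) + 1, by omega⟩ : Fin n) < ⟨i, by omega⟩) := by
    rw [Fin.lt_def]
    simp
  simp only [hlt, and_false, or_false]
  by_cases hi : i ∈ partialSums n α
  · simp only [hi, iff_true]
    apply Finset.card_lt_card
    rw [Finset.ssubset_iff_of_subset (Finset.monotone_filter_right _ fun j _ hj => by omega)]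
    exact ⟨i, by simp [hi], by simp⟩
  · simp only [hi, iff_false, not_lt]
    refine Finset.card_le_card fun j hj => ?_
    rw [Finset.mem_filter] at hj ⊢
    refine ⟨hj.1, ?_⟩
    have : (j : ℕ) ≠ i := fun h => hi (Fin.ext h ▸ hj.1)
    omega

/-- Möbius inversion on the lattice of subsets, by strong induction on the set of partial sums. -/
theorem eq_of_sum_partialSums_subset_eq {n : ℕ} {f g : Composition n → ℚ}
    (h : ∀ γ : Composition n, ∑ β : Composition n with partialSums n β ⊆ partialSums n γ, f β =
      ∑ β : Composition n with partialSums n β ⊆ partialSums n γ, g β) : f = g := by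
  have key (S : Finset (Fin (n - 1))) : ∀ γ : Composition n, partialSums n γ = S → f γ = g γ := by
    induction S using Finset.strongInduction with
    | H S ih =>
      rintro γ rfl
      have hmem : γ ∈ Finset.univ.filter
          (fun β : Composition n => partialSums n β ⊆ partialSums n γ) := by simp
      have hγ := h γ
      rw [← Finset.add_sum_erase _ _ hmem, ← Finset.add_sum_erase _ _ hmem] at hγ
      refine add_right_cancel (hγ.trans (congrArg (g γ + ·) (Finset.sum_congr rfl fun β hβ => ?_)))
      rw [Finset.mem_erase, Finset.mem_filter] at hβ
      exact (ih _ (hβ.2.2.ssubset_of_ne fun hc => hβ.1 ((partialSums n).injective hc)) β rfl).symm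
  exact funext fun γ => key _ γ rfl

namespace HopfEnd

variable (Φ : HopfEnd)

/-! ### The matrix of a Hopf endomorphism -/

theorem monomialCoeff_apply_fundamentalQ {n : ℕ} (α γ : Composition n) :
    monomialCoeff γ.blocks (Φ.toBialgHom (fundamentalQ α)) =
      ∑ β : Composition n with partialSums n β ⊆ partialSums n γ, Φ.coeffF α β := by
  rw [apply_fundamentalQ, map_sum, Finset.sum_filter]
  refine Finset.sum_congr rfl fun β _ => ?_
  rw [map_smul, monomialCoeff_fundamentalQ, smul_eq_mul, mul_ite, mul_one, mul_zero]

/-- The one-part composition is the coarsest, so only its own fundamental function contains its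
monomial function. -/
theorem coeffF_onePart {n : ℕ} (α : Composition n) :
    Φ.coeffF α (onePart n) = MvPowerSeries.coeff (Finsupp.single 0 n)
      (Φ.toBialgHom (fundamentalQ α) : MvPowerSeries ℕ ℚ) := by
  rw [← monomialCoeff_onePart, monomialCoeff_apply_fundamentalQ, partialSums_onePart]
  have : (Finset.univ.filter fun β : Composition n => partialSums n β ⊆ ∅) = {onePart n} := by
    ext β
    rw [Finset.mem_filter, Finset.subset_empty, Finset.mem_singleton, ← partialSums_onePart n]
    simp
  rw [this, Finset.sum_singleton]

theorem coeff_apply_segmentsQ {n : ℕ} (π : Equiv.Perm (Fin n)) (γ : Composition n) :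
    MvPowerSeries.coeff (Finsupp.single 0 n)
        (Φ.toBialgHom (segmentsQ (permWord π) γ.blocks) : MvPowerSeries ℕ ℚ) =
      ∑ τ : Equiv.Perm (Fin n) with partialSums n (descentComposition τ) ⊆ partialSums n γ,
        Φ.coeffF (descentComposition (π * τ⁻¹)) (onePart n) := by
  classical
  rw [segmentsQ_permWord, map_sum, AddSubmonoidClass.coe_finsetSum, map_sum]
  refine Finset.sum_congr (Finset.filter_congr fun τ _ => permDescentsIn_iff τ γ) fun τ _ => ?_
  rw [coeffF_onePart, fundamentalQ_descentComposition]

/-- Summed over the `β` refined by `γ`, both sides are the coefficient of `M_γ` in `Φ(F_{D(π)})`;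
inversion then gives each `β`. -/
theorem coeffF_descentComposition {n : ℕ} (π : Equiv.Perm (Fin n)) (β : Composition n) :
    Φ.coeffF (descentComposition π) β =
      ∑ τ : Equiv.Perm (Fin n) with descentComposition τ = β,
        Φ.coeffF (descentComposition (π * τ⁻¹)) (onePart n) := by
  refine congrFun (eq_of_sum_partialSums_subset_eq (f := Φ.coeffF (descentComposition π))
    (g := fun β => ∑ τ : Equiv.Perm (Fin n) with descentComposition τ = β,
      Φ.coeffF (descentComposition (π * τ⁻¹)) (onePart n)) fun γ => ?_) β
  have h := monomialCoeff_apply_wordQ Φ (l := γ.blocks) (fun _ ha => γ.blocks_pos ha) (permWord π)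
  rw [γ.blocks_sum, ← fundamentalQ_descentComposition, monomialCoeff_apply_fundamentalQ,
    coeff_apply_segmentsQ] at h
  rw [h, Finset.sum_filter, Finset.sum_filter]
  rw [← Finset.sum_fiberwise Finset.univ descentComposition]
  refine Finset.sum_congr rfl fun β _ => ?_
  rw [← Finset.sum_filter]
  split_ifs with hβ
  · refine Finset.sum_congr ?_ fun _ _ => rfl
    ext τ
    simp only [Finset.mem_filter, Finset.mem_univ, true_and, and_iff_left_iff_imp]
    rintro rfl
    exact hβ
  · refine Finset.sum_eq_zero fun τ hτ => ?_
    simp only [Finset.mem_filter, Finset.mem_univ, true_and] at hτ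
    exact absurd (hτ.1 ▸ hτ.2) hβ

theorem wordQ_one (w : ℕ → ℕ) : wordQ 1 w = monomialQ (Composition.ones 1) := by
  classical
  have hu (α : Composition 1) : α = Composition.ones 1 := by
    have : Fintype.card (Composition 1) ≤ 1 := by simp [composition_card]
    exact Fintype.card_le_one_iff.1 this _ _
  rw [wordQ, Finset.sum_eq_single_of_mem (Composition.ones 1)]
  · refine Finset.mem_filter.2 ⟨Finset.mem_univ _, fun i hi => ?_⟩
    omega
  · exact fun β _ hβ => absurd (hu β) hβ

/-- Each one-letter segment contributes `M_1`, whatever the letter, and `Φ` scales it by `λ`. -/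
theorem coeff_apply_segmentsQ_replicate (n : ℕ) (w : ℕ → ℕ) :
    MvPowerSeries.coeff (Finsupp.single 0 n)
      (Φ.toBialgHom (segmentsQ w (List.replicate n 1)) : MvPowerSeries ℕ ℚ) = Φ.scale ^ n := by
  induction n generalizing w with
  | zero => simp [segmentsQ]
  | succ n ih =>
    have h1 : MvPowerSeries.coeff (Finsupp.single 0 1)
        (monomialQ (Composition.ones 1) : MvPowerSeries ℕ ℚ) = 1 := by
      change MvPowerSeries.coeff (Finsupp.single 0 1) (monomialSeries (Composition.ones 1)) = 1
      rw [coeff_monomialSeries, exponentWord_single, if_pos (by simp [onePart])]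
    rw [List.replicate_succ, segmentsQ, map_mul, add_comm n 1, coeff_single_mul, ih, wordQ_one,
      apply_monomialQ_one, pow_add, pow_one]
    · change MvPowerSeries.coeff (Finsupp.single 0 1)
        (Φ.scale • (monomialQ (Composition.ones 1) : MvPowerSeries ℕ ℚ)) * _ = _
      rw [map_smul, h1, smul_eq_mul, mul_one]
    · exact Φ.map_homogeneous 1 _ (wordQ_mem 1 w)

/-- For the composition into ones every `τ` is admissible, and the product of segments is a power of
`M_1`. -/
theorem sum_coeffF_mul_inv (n : ℕ) (π : Equiv.Perm (Fin n)) :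
    ∑ τ : Equiv.Perm (Fin n), Φ.coeffF (descentComposition (π * τ⁻¹)) (onePart n) =
      Φ.scale ^ n := by
  have h := Φ.coeff_apply_segmentsQ π (Composition.ones n)
  rw [Composition.ones_blocks, coeff_apply_segmentsQ_replicate, partialSums_ones] at h
  rw [h]
  simp

theorem sum_coeffF_onePart (n : ℕ) :
    ∑ σ : Equiv.Perm (Fin n), Φ.coeffF (descentComposition σ) (onePart n) = Φ.scale ^ n := by
  rw [← Φ.sum_coeffF_mul_inv n 1]
  simp only [one_mul]
  exact (Equiv.sum_comp (Equiv.inv (Equiv.Perm (Fin n)))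
    fun σ => Φ.coeffF (descentComposition σ) (onePart n)).symm

theorem walk_eq {n : ℕ} (π τ : Equiv.Perm (Fin n)) :
    Φ.walk n π τ = Φ.coeffF (descentComposition (π * τ⁻¹)) (onePart n) / Φ.scale ^ n := by
  rw [walk, Matrix.of_apply, qsDistribution, sum_coeffF_onePart, mul_inv_rev, inv_inv]

/-- This is the lumping itself: the left side depends on `π` only through its descents. It holds
even if `λⁿ = 0`, both sides then being zero by the convention for division. -/
theorem normalizedMatrix_descentComposition {n : ℕ} (π : Equiv.Perm (Fin n))
    (β : Composition n) :
    Φ.normalizedMatrix n (descentComposition π) β =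
      ∑ σ : Equiv.Perm (Fin n) with descentComposition σ = β, Φ.walk n π σ := by
  simp only [walk_eq, ← Finset.sum_div, ← coeffF_descentComposition]
  rfl

end HopfEnd

end QuasiSym

/-! ### Positivity, stochasticity and lumping -/

theorem theorem3p1 (Φ : QuasiSym.HopfEnd) (n : ℕ)
    (hnonneg : ∀ α : Composition n, 0 ≤ Φ.coeffF α (QuasiSym.onePart n))
    (hne : ∃ α : Composition n, Φ.coeffF α (QuasiSym.onePart n) ≠ 0) :
    0 < Φ.scale ^ n ∧
      Φ.normalizedMatrix n ∈ Matrix.rowStochastic ℚ (Composition n) ∧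
      QuasiSym.LumpsByDescents (Φ.normalizedMatrix n) (Φ.walk n) := by
  have hpos : 0 < Φ.scale ^ n := by
    rw [← Φ.sum_coeffF_onePart n]
    obtain ⟨α, hα⟩ := hne
    obtain ⟨σ, rfl⟩ := QuasiSym.descentComposition_surjective n α
    exact Finset.sum_pos' (fun τ _ => hnonneg _)
      ⟨σ, Finset.mem_univ _, lt_of_le_of_ne (hnonneg _) hα.symm⟩
  have hK : Φ.walk n ∈ Matrix.rowStochastic ℚ (Equiv.Perm (Fin n)) := by
    rw [Matrix.mem_rowStochastic_iff_sum]
    refine ⟨fun π τ => ?_, fun π => ?_⟩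
    · rw [Φ.walk_eq]
      exact div_nonneg (hnonneg _) hpos.le
    · simp only [Φ.walk_eq]
      rw [← Finset.sum_div, Φ.sum_coeffF_mul_inv, div_self hpos.ne']
  rw [Matrix.mem_rowStochastic_iff_sum] at hK
  refine ⟨hpos, ?_, ⟨Matrix.mem_rowStochastic_iff_sum.2 hK, fun β π τ h => ?_,
    Φ.normalizedMatrix_descentComposition⟩⟩
  · rw [Matrix.mem_rowStochastic_iff_sum]
    refine ⟨fun α β => ?_, fun α => ?_⟩
    · obtain ⟨π, rfl⟩ := QuasiSym.descentComposition_surjective n α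
      rw [Φ.normalizedMatrix_descentComposition]
      exact Finset.sum_nonneg fun τ _ => hK.1 π τ
    · obtain ⟨π, rfl⟩ := QuasiSym.descentComposition_surjective n α
      simp only [Φ.normalizedMatrix_descentComposition]
      -- The descent classes partition the permutations, so a row of `K̄` has the same sum as a row
      -- of `K`.
      rw [Finset.sum_fiberwise, hK.2]
  · rw [← Φ.normalizedMatrix_descentComposition, ← Φ.normalizedMatrix_descentComposition, h]
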